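/- Let $K$ be a number field with algebraic closure $\overline K$, let $X$ be a projective scheme over $K$ (for example a projective variety), let $k\ge 0$ be an integer, and let $f_1,\dots,f_k\colon X\to X$ be morphisms over $K$. Let $L\in \operatorname{Pic}(X)\otimes_{\mathbb Z}\mathbb R$ be an $\mathbb R$-line bundle such that $$\sum_{i=1}^k f_i^*L = d\,L\quad\text{in }\operatorname{Pic}(X)\otimes_{\mathbb Z}\mathbb R$$ for some real number $d>k$. A Weil height function corresponding to $L$ is a function $h\colon X(\overline K)\to\mathbb R$ for which there are an integer $m\ge 0$, real numbers $r_1,\dots,r_m$ and line bundles $L_1,\dots,L_m$ on $X$, each generated by finitely many global sections $s_{i,0},\dots,s_{i,n_i}$, such that $L=\sum_i r_iL_i$ in $\operatorname{Pic}(X)\otimes_{\mathbb Z}\mathbb R$ and $$h(x)=\sum_{i=1}^m r_i\,h_{nv}\bigl(s_{i,0}(x):\dots:s_{i,n_i}(x)\bigr)+O(1)\qquad (x\in X(\overline K)),$$ where $h_{nv}$ is the absolute logarithmic naive height on $\mathbb P^{n}(\overline K)$. Then there is a unique function $\widehat h\colon X(\overline K)\to\mathbb R$ such that (i) $\widehat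 h$ is a Weil height function corresponding to $L$; (ii) $\sum_{i=1}^k\widehat h(f_i(x))=d\,\widehat h(x)$ for all $x\in X(\overline K)$. Moreover, for every Weil height function $h_L$ corresponding to $L$, one has $\widehat h=h_L+O(1)$, and for all $x\in X(\overline K)$ $$\widehat h(x)=\lim_{l\to\infty}\frac1{d^l}\sum_{(i_1,\dots,i_l)\in\{1,\dots,k\}^l}h_L\bigl(f_{i_1}\circ\cdots\circ f_{i_l}(x)\bigr).$$ -/

import Mathlib

open CategoryTheory AlgebraicGeometry TopologicalSpace Opposite Filter Topology

universe u

noncomputable section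

namespace CanonicalHeight

/-! ### Line bundles on a scheme -/

section LineBundles

variable {X Y Z : Scheme.{u}}

/-- Restriction of invertible functions from `V` to a smaller open set `U`. -/
def res {U V : X.Opens} (h : U ≤ V) : Γ(X, V)ˣ →* Γ(X, U)ˣ :=
  Units.map (X.presheaf.map (homOfLE h).op).hom

theorem res_res {U V W : X.Opens} (h : U ≤ V) (h' : V ≤ W) (a : Γ(X, W)ˣ) :
    res h (res h' a) = res (h.trans h') a := by
  ext
  simp only [res, Units.coe_map, MonoidHom.coe_coe]
  rw [← CommRingCat.comp_apply, ← Functor.map_comp, ← op_comp, homOfLE_comp]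

/-- Pullback of invertible functions along a morphism. -/
def pull (f : X ⟶ Y) (U : Y.Opens) : Γ(Y, U)ˣ →* Γ(X, f ⁻¹ᵁ U)ˣ :=
  Units.map (f.app U).hom

theorem pull_res (f : X ⟶ Y) {U V : Y.Opens} (h : U ≤ V) (a : Γ(Y, V)ˣ) :
    pull f U (res h a) = res (f.preimage_mono h) (pull f V a) := by
  ext
  simp only [res, pull, Units.coe_map, MonoidHom.coe_coe]
  rw [← CommRingCat.comp_apply, ← CommRingCat.comp_apply, f.naturality]
  rfl

/-- A line bundle on the scheme `X`, given by an open cover `U i` over which it is trivialised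
and by transition functions `g i j ∈ 𝒪(U i ∩ U j)ˣ` satisfying the cocycle condition. -/
structure LineBundle (X : Scheme.{u}) where
  /-- the index set of the cover -/
  ι : Type u
  /-- the members of the cover -/
  U : ι → X.Opens
  /-- the sets cover the scheme -/
  cover : ∀ p : X, ∃ i, p ∈ U i
  /-- the transition functions -/
  g : ∀ i j, Γ(X, U i ⊓ U j)ˣ
  /-- the cocycle condition on triple intersections -/
  cocycle : ∀ i j k,
    res (U := U i ⊓ U j ⊓ U k) inf_le_left (g i j) *
      res (le_inf (inf_le_left.trans inf_le_right) inf_le_right) (g j k) =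
    res (le_inf (inf_le_left.trans inf_le_left) inf_le_right) (g i k)

namespace LineBundle

/-- Two line bundles are isomorphic if there is a common refinement `W` of the two trivialising
covers on which their cocycles differ by a coboundary: multiplication by the invertible functions
`h a` in the local trivialisations is compatible with the transition functions. -/
def Iso (L M : LineBundle X) : Prop :=
  ∃ (κ : Type u) (W : κ → X.Opens) (_ : ∀ p : X, ∃ a, p ∈ W a)
    (α : κ → L.ι) (β : κ → M.ι) (hα : ∀ a, W a ≤ L.U (α a)) (hβ : ∀ a, W a ≤ M.U (β a))
    (h : ∀ a, Γ(X, W a)ˣ), ∀ a b,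
      res (U := W a ⊓ W b) inf_le_left (h a) *
        res (inf_le_inf (hα a) (hα b)) (L.g (α a) (α b)) =
      res (inf_le_inf (hβ a) (hβ b)) (M.g (β a) (β b)) * res inf_le_right (h b)

/-- The cocycle condition, on any open set contained in the triple intersection. -/
theorem cocycle_res (L : LineBundle X) {V : X.Opens} {i j k : L.ι} (h₁ : V ≤ L.U i ⊓ L.U j)
    (h₂ : V ≤ L.U j ⊓ L.U k) (h₃ : V ≤ L.U i ⊓ L.U k) :
    res h₁ (L.g i j) * res h₂ (L.g j k) = res h₃ (L.g i k) := by
  have hV : V ≤ L.U i ⊓ L.U j ⊓ L.U k := le_inf h₁ (h₂.trans inf_le_right)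
  have := congrArg (res hV) (L.cocycle i j k)
  simpa only [map_mul, res_res] using this

theorem Iso.refl (L : LineBundle X) : Iso L L :=
  ⟨L.ι, L.U, L.cover, id, id, fun _ => le_rfl, fun _ => le_rfl, fun _ => 1, fun a b => by
    simp only [map_one, one_mul, mul_one, id]⟩

theorem Iso.symm {L M : LineBundle X} : Iso L M → Iso M L := by
  rintro ⟨κ, W, hW, α, β, hα, hβ, h, H⟩
  refine ⟨κ, W, hW, β, α, hβ, hα, fun a => (h a)⁻¹, fun a b => ?_⟩
  simp only [map_inv]
  rw [inv_mul_eq_iff_eq_mul, ← mul_assoc, eq_mul_inv_iff_mul_eq]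
  exact (H a b).symm

theorem Iso.trans {L M N : LineBundle X} : Iso L M → Iso M N → Iso L N := by
  rintro ⟨κ, W, hW, α, β, hα, hβ, h, H⟩ ⟨κ', W', hW', β', γ, hβ', hγ, h', H'⟩
  refine ⟨κ × κ', fun c => W c.1 ⊓ W' c.2, fun p => ?_, fun c => α c.1, fun c => γ c.2,
    fun c => inf_le_left.trans (hα c.1), fun c => inf_le_right.trans (hγ c.2),
    fun c => res inf_le_left (h c.1) * res inf_le_right (h' c.2) *
      res (le_inf (inf_le_right.trans (hβ' c.2)) (inf_le_left.trans (hβ c.1)))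
        (M.g (β' c.2) (β c.1)), ?_⟩
  · obtain ⟨a, ha⟩ := hW p
    obtain ⟨b, hb⟩ := hW' p
    exact ⟨(a, b), ha, hb⟩
  · rintro ⟨a, a'⟩ ⟨b, b'⟩
    have h1 : W a ⊓ W' a' ⊓ (W b ⊓ W' b') ≤ W a ⊓ W b := inf_le_inf inf_le_left inf_le_left
    have h2 : W a ⊓ W' a' ⊓ (W b ⊓ W' b') ≤ W' a' ⊓ W' b' :=
      inf_le_inf inf_le_right inf_le_right
    have E := congrArg (res h1) (H a b)
    have E' := congrArg (res h2) (H' a' b')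
    simp only [map_mul, res_res] at E E' ⊢
    have C₁ := M.cocycle_res (i := β' a') (j := β a) (k := β b)
      (V := W a ⊓ W' a' ⊓ (W b ⊓ W' b'))
      (le_inf (h2.trans (inf_le_left.trans (hβ' _))) (h1.trans (inf_le_left.trans (hβ _))))
      (h1.trans (inf_le_inf (hβ _) (hβ _)))
      (le_inf (h2.trans (inf_le_left.trans (hβ' _))) (h1.trans (inf_le_right.trans (hβ _))))
    have C₂ := M.cocycle_res (i := β' a') (j := β' b') (k := β b)
      (V := W a ⊓ W' a' ⊓ (W b ⊓ W' b'))
      (h2.trans (inf_le_inf (hβ' _) (hβ' _)))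
      (le_inf (h2.trans (inf_le_right.trans (hβ' _))) (h1.trans (inf_le_right.trans (hβ _))))
      (le_inf (h2.trans (inf_le_left.trans (hβ' _))) (h1.trans (inf_le_right.trans (hβ _))))
    generalize res _ (h a) = A at *
    generalize res _ (h b) = B at *
    generalize res _ (h' a') = A' at *
    generalize res _ (h' b') = B' at *
    generalize res _ (M.g (β' a') (β a)) = m₁ at *
    generalize res _ (M.g (β' b') (β b)) = m₂ at *
    generalize res _ (M.g (β' a') (β b)) = m₃ at *
    generalize res _ (M.g (β a) (β b)) = m₄ at *
    generalize res _ (M.g (β' a') (β' b')) = m₅ at *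
    generalize res _ (L.g _ _) = l at *
    generalize res _ (N.g _ _) = n at *
    calc A * A' * m₁ * l = A' * m₁ * (A * l) := by
          rw [mul_comm A A', mul_assoc A', mul_comm A m₁]; simp only [mul_assoc]
      _ = A' * (m₁ * m₄) * B := by rw [E]; simp only [mul_assoc]
      _ = (A' * m₅) * m₂ * B := by rw [C₁, ← C₂]; simp only [mul_assoc]
      _ = n * (B * B' * m₂) := by
          rw [E', mul_comm B B', mul_assoc B', mul_comm B m₂]; simp only [mul_assoc]

/-- Isomorphism of line bundles as an equivalence relation. -/
instance isoSetoid (X : Scheme.{u}) : Setoid (LineBundle X) where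
  r := Iso
  iseqv := ⟨Iso.refl, Iso.symm, Iso.trans⟩

/-- The trivial line bundle. -/
def trivial (X : Scheme.{u}) : LineBundle X where
  ι := PUnit
  U _ := ⊤
  cover _ := ⟨PUnit.unit, by trivial⟩
  g _ _ := 1
  cocycle _ _ _ := by simp only [map_one, mul_one]

/-- The tensor product of two line bundles: the transition functions are multiplied. -/
def tensor (L M : LineBundle X) : LineBundle X where
  ι := L.ι × M.ι
  U i := L.U i.1 ⊓ M.U i.2
  cover p := by
    obtain ⟨i, hi⟩ := L.cover p
    obtain ⟨j, hj⟩ := M.cover p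
    exact ⟨(i, j), hi, hj⟩
  g i j := res (inf_le_inf inf_le_left inf_le_left) (L.g i.1 j.1) *
    res (inf_le_inf inf_le_right inf_le_right) (M.g i.2 j.2)
  cocycle i j k := by
    simp only [map_mul, res_res]
    rw [mul_mul_mul_comm, L.cocycle_res, M.cocycle_res]

/-- The dual line bundle: the transition functions are inverted. -/
def dual (L : LineBundle X) : LineBundle X where
  ι := L.ι
  U := L.U
  cover := L.cover
  g i j := (L.g i j)⁻¹
  cocycle i j k := by
    simp only [map_inv]
    rw [← mul_inv, L.cocycle_res]

/-- The pullback of a line bundle along a morphism of schemes. -/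
def pullback (f : X ⟶ Y) (L : LineBundle Y) : LineBundle X where
  ι := L.ι
  U i := f ⁻¹ᵁ L.U i
  cover p := L.cover (f p)
  g i j := pull f (L.U i ⊓ L.U j) (L.g i j)
  cocycle i j k := by
    have := congrArg (pull f _) (L.cocycle i j k)
    rwa [map_mul, pull_res, pull_res, pull_res] at this

theorem res_tensor_g (L M : LineBundle X) {V : X.Opens} (i j : L.ι × M.ι)
    (h : V ≤ (L.tensor M).U i ⊓ (L.tensor M).U j) :
    res h ((L.tensor M).g i j) =
      res (h.trans (inf_le_inf inf_le_left inf_le_left)) (L.g i.1 j.1) *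
        res (h.trans (inf_le_inf inf_le_right inf_le_right)) (M.g i.2 j.2) :=
  (map_mul (res h) _ _).trans (congrArg₂ _ (res_res _ _ _) (res_res _ _ _))

theorem res_dual_g (L : LineBundle X) {V : X.Opens} (i j : L.ι)
    (h : V ≤ L.U i ⊓ L.U j) : res h (L.dual.g i j) = (res h (L.g i j))⁻¹ :=
  map_inv (res h) _

theorem res_trivial_g {V : X.Opens} (i j : PUnit)
    (h : V ≤ (trivial X).U i ⊓ (trivial X).U j) : res h ((trivial X).g i j) = 1 :=
  map_one (res h)

/-- Line bundles whose cocycles agree on a common refinement are isomorphic. -/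
theorem iso_of_eq {L M : LineBundle X} {κ : Type u} (W : κ → X.Opens)
    (hW : ∀ p : X, ∃ a, p ∈ W a) (α : κ → L.ι) (β : κ → M.ι)
    (hα : ∀ a, W a ≤ L.U (α a)) (hβ : ∀ a, W a ≤ M.U (β a))
    (H : ∀ a b, res (inf_le_inf (hα a) (hα b)) (L.g (α a) (α b)) =
      res (inf_le_inf (hβ a) (hβ b)) (M.g (β a) (β b))) : L ≈ M :=
  ⟨κ, W, hW, α, β, hα, hβ, fun _ => 1, fun a b => by
    rw [map_one, map_one, one_mul, mul_one, H]⟩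

theorem tensor_congr {L L' M M' : LineBundle X} : L ≈ L' → M ≈ M' →
    L.tensor M ≈ L'.tensor M' := by
  rintro ⟨κ, W, hW, α, β, hα, hβ, h, H⟩ ⟨κ', W', hW', α', β', hα', hβ', h', H'⟩
  refine ⟨κ × κ', fun c => W c.1 ⊓ W' c.2, fun p => ?_, fun c => (α c.1, α' c.2),
    fun c => (β c.1, β' c.2), fun c => inf_le_inf (hα _) (hα' _),
    fun c => inf_le_inf (hβ _) (hβ' _),
    fun c => res inf_le_left (h c.1) * res inf_le_right (h' c.2), ?_⟩
  · obtain ⟨a, ha⟩ := hW p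
    obtain ⟨b, hb⟩ := hW' p
    exact ⟨(a, b), ha, hb⟩
  · rintro ⟨a, a'⟩ ⟨b, b'⟩
    have E := congrArg (res (U := W a ⊓ W' a' ⊓ (W b ⊓ W' b'))
      (inf_le_inf inf_le_left inf_le_left)) (H a b)
    have E' := congrArg (res (U := W a ⊓ W' a' ⊓ (W b ⊓ W' b'))
      (inf_le_inf inf_le_right inf_le_right)) (H' a' b')
    simp only [map_mul, res_res] at E E' ⊢
    rw [res_tensor_g, res_tensor_g, mul_mul_mul_comm, E, E', mul_mul_mul_comm]

theorem dual_congr {L L' : LineBundle X} : L ≈ L' → L.dual ≈ L'.dual := by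
  rintro ⟨κ, W, hW, α, β, hα, hβ, h, H⟩
  refine ⟨κ, W, hW, α, β, hα, hβ, fun a => (h a)⁻¹, fun a b => ?_⟩
  refine (congrArg₂ _ (map_inv _ _) (res_dual_g L _ _ _)).trans (Eq.trans ?_
    (congrArg₂ _ (res_dual_g L' _ _ _) (map_inv _ _)).symm)
  rw [← mul_inv, ← mul_inv, H]

theorem pullback_congr (f : X ⟶ Y) {L L' : LineBundle Y} : L ≈ L' →
    L.pullback f ≈ L'.pullback f := by
  rintro ⟨κ, W, hW, α, β, hα, hβ, h, H⟩
  refine ⟨κ, fun a => f ⁻¹ᵁ W a, fun p => hW (f p), α, β, fun a => f.preimage_mono (hα a),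
    fun a => f.preimage_mono (hβ a), fun a => pull f _ (h a), fun a b => ?_⟩
  have E := congrArg (pull f _) (H a b)
  rwa [map_mul, map_mul, pull_res, pull_res, pull_res, pull_res] at E

theorem pull_mul_res (f : X ⟶ Y) {U V V' : Y.Opens} (h : U ≤ V) (h' : U ≤ V')
    (a : Γ(Y, V)ˣ) (b : Γ(Y, V')ˣ) :
    pull f U (res h a * res h' b) =
      res (f.preimage_mono h) (pull f V a) * res (f.preimage_mono h') (pull f V' b) := by
  rw [map_mul, pull_res, pull_res]

theorem pullback_tensor (f : X ⟶ Y) (L M : LineBundle Y) :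
    (L.tensor M).pullback f ≈ (L.pullback f).tensor (M.pullback f) :=
  iso_of_eq (κ := L.ι × M.ι) (fun i => f ⁻¹ᵁ (L.U i.1 ⊓ M.U i.2)) ((L.tensor M).pullback f).cover
    (fun i => i) (fun i => i) (fun _ => le_rfl) (fun _ => le_rfl) fun _ _ =>
      congrArg (res _) (pull_mul_res f _ _ _ _)

end LineBundle

/-- The Picard group of a scheme: isomorphism classes of line bundles under tensor product. -/
def Pic (X : Scheme.{u}) : Type (u + 1) := Quotient (LineBundle.isoSetoid X)

namespace Pic

/-- The isomorphism class of a line bundle. -/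
def mk (L : LineBundle X) : Pic X := Quotient.mk _ L

instance : CommGroup (Pic X) where
  mul := Quotient.map₂ LineBundle.tensor fun _ _ h _ _ h' => LineBundle.tensor_congr h h'
  one := mk (LineBundle.trivial X)
  inv := Quotient.map LineBundle.dual fun _ _ h => LineBundle.dual_congr h
  mul_assoc := by
    rintro ⟨L⟩ ⟨M⟩ ⟨N⟩
    refine Quotient.sound (LineBundle.iso_of_eq ((L.tensor M).tensor N).U
      ((L.tensor M).tensor N).cover id (fun i => (i.1.1, (i.1.2, i.2))) (fun _ => le_rfl)
      (fun _ => inf_assoc _ _ _ |>.le) fun a b => ?_)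
    refine ((LineBundle.res_tensor_g (L.tensor M) N a b _).trans
      (congrArg (· * _) (LineBundle.res_tensor_g L M a.1 b.1 _))).trans ?_
    refine Eq.trans ?_ ((LineBundle.res_tensor_g L (M.tensor N) (a.1.1, (a.1.2, a.2))
      (b.1.1, (b.1.2, b.2)) _).trans
      (congrArg (_ * ·) (LineBundle.res_tensor_g M N (a.1.2, a.2) (b.1.2, b.2) _))).symm
    exact mul_assoc _ _ _
  one_mul := by
    rintro ⟨L⟩
    refine Quotient.sound (LineBundle.iso_of_eq L.U L.cover (fun i => (PUnit.unit, i)) id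
      (fun _ => le_inf le_top le_rfl) (fun _ => le_rfl) fun a b => ?_)
    rw [LineBundle.res_tensor_g, LineBundle.res_trivial_g, one_mul]
    rfl
  mul_one := by
    rintro ⟨L⟩
    refine Quotient.sound (LineBundle.iso_of_eq L.U L.cover (fun i => (i, PUnit.unit)) id
      (fun _ => le_inf le_rfl le_top) (fun _ => le_rfl) fun a b => ?_)
    rw [LineBundle.res_tensor_g, LineBundle.res_trivial_g, mul_one]
    rfl
  inv_mul_cancel := by
    rintro ⟨L⟩
    refine Quotient.sound (LineBundle.iso_of_eq L.U L.cover (fun i => (i, i))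
      (fun _ => PUnit.unit) (fun _ => le_inf le_rfl le_rfl) (fun _ => le_top) fun a b => ?_)
    rw [LineBundle.res_tensor_g, LineBundle.res_trivial_g]
    exact (congrArg (· * _) (LineBundle.res_dual_g L a b _)).trans (inv_mul_cancel _)
  mul_comm := by
    rintro ⟨L⟩ ⟨M⟩
    refine Quotient.sound (LineBundle.iso_of_eq (L.tensor M).U (L.tensor M).cover id Prod.swap
      (fun _ => le_rfl) (fun _ => inf_comm _ _ |>.le) fun a b => ?_)
    exact (LineBundle.res_tensor_g L M a b _).trans ((mul_comm _ _).trans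
      (LineBundle.res_tensor_g M L (Prod.swap a) (Prod.swap b) _).symm)

/-- Pullback of isomorphism classes of line bundles, as a group homomorphism. -/
def pullback (f : X ⟶ Y) : Pic Y →* Pic X :=
  MonoidHom.mk' (Quotient.map (LineBundle.pullback f) fun _ _ h => LineBundle.pullback_congr f h)
    (by
      rintro ⟨L⟩ ⟨M⟩
      exact Quotient.sound (LineBundle.pullback_tensor f L M))

end Pic

/-- The group `Pic X ⊗ ℝ` of `ℝ`-line bundles on `X` (up to isomorphism), written additively. -/
abbrev RPic (X : Scheme.{u}) : Type (u + 1) := TensorProduct ℤ ℝ (Additive (Pic X))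

namespace RPic

/-- The class of a line bundle in `Pic X ⊗ ℝ`. -/
def of (L : LineBundle X) : RPic X := TensorProduct.tmul ℤ (1 : ℝ) (Additive.ofMul (Pic.mk L))

/-- Pullback of `ℝ`-line bundles along a morphism. -/
def pullback (f : X ⟶ Y) : RPic Y →ₗ[ℝ] RPic X :=
  LinearMap.baseChange ℝ (MonoidHom.toAdditive (Pic.pullback f)).toIntLinearMap

end RPic

/-- A global section of a line bundle: functions on the members of the trivialising cover which
match under the transition functions. -/
structure LineBundle.GlobalSection (L : LineBundle X) where
  /-- the section in the local trivialisations -/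
  s : ∀ i, Γ(X, L.U i)
  /-- the local expressions match -/
  compat : ∀ i j, X.presheaf.map (homOfLE inf_le_left).op (s i) =
    (L.g i j : Γ(X, L.U i ⊓ L.U j)) * X.presheaf.map (homOfLE inf_le_right).op (s j)

/-- A line bundle together with global sections `s 0, …, s n` which generate it (at each point
some `s j` does not vanish). Up to isomorphism this is the same as a morphism `X ⟶ ℙⁿ`, namely
`x ↦ (s 0 x : … : s n x)`; the bundle is the pullback of `𝒪(1)` and the sections are the
pullbacks of the homogeneous coordinates. -/
structure GeneratedBundle (X : Scheme.{u}) where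
  /-- the line bundle -/
  L : LineBundle X
  /-- the dimension of the projective space -/
  n : ℕ
  /-- the sections -/
  s : Fin (n + 1) → L.GlobalSection
  /-- the sections generate the line bundle -/
  generate : ∀ p : X, ∃ j i, p ∈ X.basicOpen ((s j).s i)

end LineBundles

/-! ### Projective schemes over a field and their geometric points -/

section Points

attribute [local instance] MvPolynomial.gradedAlgebra

/-- Projective space of dimension `n` over the field `K`, as a scheme over `K`. -/
def projectiveSpace (K : Type u) [Field K] (n : ℕ) : Over (Spec (CommRingCat.of K)) :=
  Over.mk (Proj.toSpecZero (MvPolynomial.homogeneousSubmodule (Fin (n + 1)) K) ≫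
    Spec.map (CommRingCat.ofHom
      (algebraMap K (MvPolynomial.homogeneousSubmodule (Fin (n + 1)) K 0))))

/-- A scheme over `K` is projective if it is isomorphic over `K` to a closed subscheme of a
projective space over `K`. -/
def IsProjective {K : Type u} [Field K] (X : Over (Spec (CommRingCat.of K))) : Prop :=
  ∃ (n : ℕ) (j : X ⟶ projectiveSpace K n), IsClosedImmersion j.left

/-- The set `X(K̄)` of geometric points of the `K`-scheme `X`. -/
abbrev GeomPoint {K : Type u} [Field K] (X : Over (Spec (CommRingCat.of K))) : Type u :=
  Over.mk (Spec.map (CommRingCat.ofHom (algebraMap K (AlgebraicClosure K)))) ⟶ X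

/-- The value at a point `x ∈ X(E)` of a function defined on a neighbourhood of the point. -/
def value {X : Scheme.{u}} {E : Type u} [Field E] (x : Spec (CommRingCat.of E) ⟶ X)
    {U : X.Opens} (hx : x (IsLocalRing.closedPoint E) ∈ U) (a : Γ(X, U)) : E :=
  (Scheme.stalkClosedPointTo x).hom ((X.presheaf.germ U _ hx).hom a)

end Points

/-! ### Heights -/

section Heights

variable {K : Type u} [Field K] [NumberField K]

/-- The logarithmic naive height of the point with homogeneous coordinates `x i ∈ K̄` in projective
space. It is computed in the number field `F` generated over `K` by the coordinates, as
`[F : ℚ]⁻¹` times the sum over all places of `F` (with the usual normalisations)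
of `log (max |x i|_v)`. -/
def naiveHeight {n : ℕ} (x : Fin (n + 1) → AlgebraicClosure K) : ℝ :=
  haveI : FiniteDimensional K (IntermediateField.adjoin K (Set.range x)) :=
    IntermediateField.finiteDimensional_adjoin fun y _ =>
      (Algebra.IsAlgebraic.isAlgebraic (R := K) y).isIntegral
  haveI : NumberField (IntermediateField.adjoin K (Set.range x)) :=
    NumberField.of_module_finite K _
  Height.logHeight (fun i => (⟨x i, IntermediateField.subset_adjoin K _ (Set.mem_range_self i)⟩ :
    IntermediateField.adjoin K (Set.range x))) /
      (Module.finrank ℚ (IntermediateField.adjoin K (Set.range x)) : ℝ)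

/-- The height `x ↦ h (s 0 x : … : s n x)` on `X(K̄)` attached to a line bundle with generating
sections; the sections are evaluated in some local trivialisation around `x`. -/
def GeneratedBundle.height {X : Over (Spec (CommRingCat.of K))} (G : GeneratedBundle X.left)
    (x : GeomPoint X) : ℝ :=
  naiveHeight fun j => value x.left
    (G.L.cover (x.left (IsLocalRing.closedPoint (AlgebraicClosure K)))).choose_spec
    ((G.s j).s _)

/-- `h` is a Weil height function corresponding to the `ℝ`-line bundle `L`, i.e. a representative
of `h_L` modulo bounded functions: `L` is written as a real linear combination of
line bundles with generating sections, and `h` is, up to a bounded function, the same combination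
of the naive heights of their maps to projective spaces. -/
def IsWeilHeight {X : Over (Spec (CommRingCat.of K))} (L : RPic X.left)
    (h : GeomPoint X → ℝ) : Prop :=
  ∃ (m : ℕ) (r : Fin m → ℝ) (G : Fin m → GeneratedBundle X.left),
    L = ∑ i, r i • RPic.of (G i).L ∧
    ∃ C : ℝ, ∀ x, |h x - ∑ i, r i * (G i).height x| ≤ C

end Heights

/-- The composite `f_{w 0} ∘ f_{w 1} ∘ ⋯ ∘ f_{w (l-1)}`. -/
def wordMap {C : Type*} [Category C] {X : C} {k : ℕ} (f : Fin k → (X ⟶ X)) :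
    (l : ℕ) → (Fin l → Fin k) → (X ⟶ X)
  | 0, _ => 𝟙 X
  | l + 1, w => wordMap f l (Fin.tail w) ≫ f (w 0)

end CanonicalHeight

end

/-! By Tate's argument everything reduces to one fact: sending a generated bundle to its height,
modulo bounded functions, extends to an `ℝ`-linear map on `Pic X ⊗ ℝ` compatible with pullback.
Granting this (`heightClass`), the hypothesis on `L` says that the operator `T h = ∑ h ∘ f_i`
satisfies `T h = d h + O(1)` for each Weil height `h` of `L`. Each application of `T` multiplies a
bound by at most `k < d`, so `T^l h / d^l` is uniformly Cauchy. Its limit is an eigenfunction within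
`O(1)` of `h`, and a bounded eigenfunction with eigenvalue `d` is zero, which gives uniqueness.

The linear map rests on three facts. Additivity under tensor products is the Segre formula
(`naiveHeight_segre`).

Independence of the sections, up to `O(1)`, is proved by integrality. If the `s_j` generate a line
bundle on a proper `X` and `t` is another section of it, then `s_j / t` satisfies a polynomial
equation over `K` with constant coefficient `1`. Otherwise some valuation ring would make all `s_j /
t` small, while the valuative criterion extends the point over that ring and some `s_j` generates
the bundle at its closed point. Such an equation bounds `|t|_v` by a constant times `max |s_j|_v` at
every place (`exists_aeval_eq_zero`, `mulHeight_le_of_aeval_div_eq_zero`).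

Finally, every line bundle on a projective scheme is a difference of two generated ones
(`IsProjective.exists_generatedBundle`): local frames, multiplied by high powers of sections of an
ample bundle, extend to global sections. -/

/-! ### Heights under extension of number fields -/

namespace NumberField

open Height
variable {F E : Type*} [Field F] [NumberField F] [Field E] [NumberField E]

/-- Exactly `v.mult` embeddings induce the place `v`. Embeddings are easier to count in an extension
than places. -/
theorem prod_infinitePlace_pow_mult (f : InfinitePlace F → ℝ) :
    ∏ v : InfinitePlace F, f v ^ v.mult = ∏ φ : F →+* ℂ, f (.mk φ) := by
  classical
  rw [← Finset.prod_fiberwise Finset.univ InfinitePlace.mk (fun φ : F →+* ℂ => f (.mk φ))]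
  refine Finset.prod_congr rfl fun v _ => ?_
  rw [Finset.prod_congr rfl (g := fun _ => f v)
    fun φ hφ => by rw [(Finset.mem_filter.mp hφ).2], Finset.prod_const,
    InfinitePlace.card_filter_mk_eq]

theorem card_filter_comp_algebraMap_eq [Algebra F E] (φ : F →+* ℂ) [DecidableEq (F →+* ℂ)] :
    (Finset.univ.filter fun ψ : E →+* ℂ => ψ.comp (algebraMap F E) = φ).card =
      Module.finrank F E := by
  let _ := φ.toAlgebra
  have : FiniteDimensional F E := Module.Finite.of_restrictScalars_finite ℚ F E
  rw [← AlgHom.card F E ℂ, ← Fintype.card_coe]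
  refine Fintype.card_congr ⟨fun ψ => ⟨ψ.1, fun r =>
    DFunLike.congr_fun (Finset.mem_filter.mp ψ.2).2 r⟩, fun σ => ⟨σ.toRingHom,
    Finset.mem_filter.mpr ⟨Finset.mem_univ _, σ.comp_algebraMap⟩⟩, fun _ => rfl, fun _ => rfl⟩

theorem prod_infinitePlace_extension [Algebra F E] {ι : Type*} (x : ι → F) :
    ∏ w : InfinitePlace E, (⨆ i, w (algebraMap F E (x i))) ^ w.mult =
      (∏ v : InfinitePlace F, (⨆ i, v (x i)) ^ v.mult) ^ Module.finrank F E := by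
  classical
  rw [prod_infinitePlace_pow_mult fun w : InfinitePlace E => ⨆ i, w (algebraMap F E (x i)),
    prod_infinitePlace_pow_mult fun v : InfinitePlace F => ⨆ i, v (x i),
    ← Finset.prod_fiberwise Finset.univ (fun ψ : E →+* ℂ => ψ.comp (algebraMap F E)),
    ← Finset.prod_pow]
  refine Finset.prod_congr rfl fun φ _ => ?_
  rw [← card_filter_comp_algebraMap_eq (E := E) φ]
  refine Finset.prod_eq_pow_card fun ψ hψ => ?_
  rw [← (Finset.mem_filter.mp hψ).2]
  rfl

/-- For integral coordinates the product over finite places is the inverse of the norm of the ideal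
they generate, and extending an ideal to `𝓞 E` raises its norm to the power `[E : F]`. The splitting
of places need not be examined. -/
theorem finprod_finitePlace_extension [Algebra F E] {ι : Type*} [Finite ι] {x : ι → 𝓞 F}
    (hx : x ≠ 0) :
    ∏ᶠ w : FinitePlace E, ⨆ i, w (algebraMap F E (x i)) =
      (∏ᶠ v : FinitePlace F, ⨆ i, v (x i)) ^ Module.finrank F E := by
  have hy : (fun i => algebraMap (𝓞 F) (𝓞 E) (x i)) ≠ 0 := by
    obtain ⟨i, hi⟩ := Function.ne_iff.mp hx
    exact Function.ne_iff.mpr ⟨i, by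
      simpa using (FaithfulSMul.algebraMap_injective (𝓞 F) (𝓞 E)).ne hi⟩
  have h1 := absNorm_mul_finprod_finitePlace_eq_one hx
  have h2 := absNorm_mul_finprod_finitePlace_eq_one hy
  have h3 : Ideal.span (Set.range fun i => algebraMap (𝓞 F) (𝓞 E) (x i)) =
      (Ideal.span (Set.range x)).map (algebraMap (𝓞 F) (𝓞 E)) := by
    rw [Ideal.map_span, ← Set.range_comp]; rfl
  have : FiniteDimensional F E := Module.Finite.of_restrictScalars_finite ℚ F E
  have h4 : ((Ideal.span (Set.range x)).map (algebraMap (𝓞 F) (𝓞 E))).absNorm =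
    (Ideal.span (Set.range x)).absNorm ^ Module.finrank F E := by
    rw [Ideal.absNorm_algebraMap,
      ← IsFractionRing.finrank_eq (𝓞 F) F (𝓞 E) E]
  rw [h3, h4, Nat.cast_pow] at h2
  have h5 := congrArg (· ^ Module.finrank F E) h1
  simp only [mul_pow, one_pow] at h5
  exact mul_left_cancel₀ (left_ne_zero_of_mul_eq_one h2) (h2.trans h5.symm)

/-- Both heights are invariant under scaling, so denominators may be cleared. The zero tuple has
height `1` by convention and is treated apart. -/
theorem mulHeight_extension [Algebra F E] {ι : Type*} [Finite ι] (x : ι → F) :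
    mulHeight (fun i => algebraMap F E (x i)) = mulHeight x ^ Module.finrank F E := by
  rcases eq_or_ne x 0 with rfl | hx
  · have : (fun i : ι => algebraMap F E ((0 : ι → F) i)) = 0 := by ext; simp
    rw [this, mulHeight_zero, mulHeight_zero, one_pow]
  obtain ⟨⟨b, hb0⟩, hb⟩ := IsLocalization.exist_integer_multiples_of_finite (nonZeroDivisors (𝓞 F)) x
  choose y hy using hb
  replace hb0 : (b : F) ≠ 0 := by simpa using hb0
  have hy' : (fun i => (y i : F)) = (b : F) • x := by
    ext i; rw [Pi.smul_apply, smul_eq_mul]; exact (hy i).trans (Algebra.smul_def _ _)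
  have hyx : y ≠ 0 := by
    rintro rfl
    refine hx (smul_right_injective _ hb0 ?_)
    simp only [smul_zero]; rw [← hy']; ext; simp
  have hE : (fun i => algebraMap F E (y i)) = algebraMap F E b • fun i => algebraMap F E (x i) := by
    ext i
    rw [congrFun hy' i]
    simp
  have hbE : algebraMap F E b ≠ 0 := by simpa using hb0
  have e1 := mulHeight_smul_eq_mulHeight x hb0
  have e2 := mulHeight_smul_eq_mulHeight (fun i => algebraMap F E (x i)) hbE
  rw [← hy'] at e1
  rw [← hE] at e2
  have n1 : (fun i => (y i : F)) ≠ 0 := by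
    rw [hy']; exact smul_ne_zero hb0 hx
  have n2 : (fun i => algebraMap F E (y i)) ≠ 0 := by
    obtain ⟨i, hi⟩ := Function.ne_iff.mp n1
    exact Function.ne_iff.mpr ⟨i, by simpa using hi⟩
  rw [← e1, ← e2, mulHeight_eq n1, mulHeight_eq n2, mul_pow, ← finprod_finitePlace_extension hyx,
    ← prod_infinitePlace_extension]

theorem logHeight_extension_div [Algebra F E] {ι : Type*} [Finite ι] (x : ι → F) :
    logHeight (fun i => algebraMap F E (x i)) / (Module.finrank ℚ E : ℝ) =
      logHeight x / (Module.finrank ℚ F : ℝ) := by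
  have : FiniteDimensional F E := Module.Finite.of_restrictScalars_finite ℚ F E
  have h : (Module.finrank F E : ℝ) ≠ 0 := Nat.cast_ne_zero.mpr Module.finrank_pos.ne'
  rw [logHeight_eq_log_mulHeight, mulHeight_extension, Real.log_pow,
    ← logHeight_eq_log_mulHeight, ← Module.finrank_mul_finrank ℚ F E, Nat.cast_mul,
    mul_comm (Module.finrank ℚ F : ℝ), mul_div_mul_left _ _ h]

end NumberField

/-! ### Height bounds from integral equations -/

namespace AbsoluteValue

/-- If `t` is integral over `s` in the graded sense, by an equation `P (s / t) = 0` with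
constant coefficient `1`, then `|t|` is bounded by a multiple of `max |s j|`. The number `N`
accounts for the failure of the ultrametric inequality. -/
theorem apply_le_of_aeval_div_eq_zero {K F ι : Type*} [Field K] [Field F] [Algebra K F]
    [Finite ι] (v : AbsoluteValue F ℝ) {P : MvPolynomial ι K} (hP : P.constantCoeff = 1)
    {s : ι → F} {t : F} (h : t ≠ 0 → MvPolynomial.aeval (fun j => s j / t) P = 0)
    {N B : ℝ} (hN : 1 ≤ N) (hB : ∀ d, v (algebraMap K F (P.coeff d)) ≤ B)
    (hsum : ∀ (T : Finset (ι →₀ ℕ)) (g : (ι →₀ ℕ) → F) (r : ℝ), T ⊆ P.support → 0 ≤ r →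
      (∀ d ∈ T, v (g d) ≤ r) → v (∑ d ∈ T, g d) ≤ N * r) :
    v t ≤ N * B * ⨆ j, v (s j) := by
  classical
  have hB1 : 1 ≤ B := by
    have := hB 0
    rwa [← MvPolynomial.constantCoeff_eq, hP, map_one, map_one] at this
  have hM : 0 ≤ ⨆ j, v (s j) := Real.iSup_nonneg fun j => v.nonneg _
  by_contra! hlt
  have hNB : 1 ≤ N * B := one_le_mul_of_one_le_of_one_le hN hB1
  have ht : 0 < v t := (mul_nonneg (by linarith) hM).trans_lt hlt
  have ht0 : t ≠ 0 := v.pos_iff.mp ht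
  -- If the bound failed, all `s j / t` would have absolute value at most `q`, with `N * B * q < 1`.
  set q := (⨆ j, v (s j)) / v t with hq
  have hq0 : 0 ≤ q := div_nonneg hM ht.le
  have hq1 : N * (B * q) < 1 := by
    rw [hq, ← mul_assoc, ← mul_div_assoc, div_lt_one ht]; exact hlt
  have hqle : q ≤ 1 := by
    have : q ≤ N * B * q := le_mul_of_one_le_left hq0 hNB
    linarith
  have hu : ∀ j, v (s j / t) ≤ q := fun j => by
    rw [map_div₀]
    exact div_le_div_of_nonneg_right (Finite.le_ciSup (fun j => v (s j)) j) ht.le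
  have key := h ht0
  rw [MvPolynomial.aeval_def, MvPolynomial.eval₂_eq] at key
  have h0 : (0 : ι →₀ ℕ) ∈ P.support := by
    rw [MvPolynomial.mem_support_iff, ← MvPolynomial.constantCoeff_eq, hP]; exact one_ne_zero
  rw [← Finset.add_sum_erase _ _ h0, ← MvPolynomial.constantCoeff_eq, hP] at key
  simp only [map_one, Finsupp.support_zero, Finset.prod_empty, mul_one] at key
  have := hsum (P.support.erase 0)
    (fun d => algebraMap K F (P.coeff d) * ∏ i ∈ d.support, (s i / t) ^ d i) (B * q)
    (Finset.erase_subset _ _) (by positivity) fun d hd => by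
      rw [map_mul, map_prod]
      refine mul_le_mul (hB d) ?_ (Finset.prod_nonneg fun _ _ => v.nonneg _) (by linarith)
      -- A nonconstant monomial has at least one factor bounded by `q`; all the others are at most
      -- `1`.
      obtain ⟨i, hi⟩ := Finsupp.support_nonempty_iff.mpr (Finset.ne_of_mem_erase hd)
      rw [← Finset.mul_prod_erase _ _ hi]
      refine (mul_le_of_le_one_right (v.nonneg _) (Finset.prod_le_one (fun _ _ => v.nonneg _)
        fun j _ => ?_)).trans ?_
      · rw [map_pow]; exact pow_le_one₀ (v.nonneg _) ((hu j).trans hqle)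
      · rw [map_pow]
        exact (pow_le_of_le_one (v.nonneg _) ((hu i).trans hqle)
          (Finsupp.mem_support_iff.mp hi)).trans (hu i)
  -- The constant term `1` is minus the sum of the other terms, whose absolute value is less than
  -- `1`.
  rw [eq_neg_of_add_eq_zero_right key, v.map_neg, map_one] at this
  linarith

end AbsoluteValue

namespace Height

variable {K F : Type*} [Field K] [Field F] [AdmissibleAbsValues F]

open AdmissibleAbsValues

/-- A zero coordinate has absolute value `0`, never `1`, so the supremum is first restricted to the
nonzero coordinates. The finiteness is what allows `finprod` to be multiplied and compared. -/
theorem hasFiniteMulSupport_iSup {ι : Type*} [Finite ι] {x : ι → F} (hx : x ≠ 0) :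
    (fun v : nonarchAbsVal (K := F) => ⨆ i, v.val (x i)).HasFiniteMulSupport := by
  have : Nonempty {j // x j ≠ 0} := nonempty_subtype.mpr (Function.ne_iff.mp hx)
  have h : (fun v : nonarchAbsVal (K := F) => ⨆ i : {j // x j ≠ 0}, v.val (x i)) =
      fun v => ⨆ i, v.val (x i) :=
    funext fun v => (Finite.iSup_eq_iSup_subtype (v := v.val) hx).symm
  rw [← h]
  exact .iSup fun i => hasFiniteMulSupport i.2

/-- Comparison of the heights of two tuples which satisfy integral equations. -/
theorem mulHeight_le_of_aeval_div_eq_zero [Algebra K F] {ι κ : Type*} [Finite ι] [Fintype κ]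
    (P : κ → MvPolynomial ι K) (hP : ∀ i, (P i).constantCoeff = 1) {s : ι → F} (hs : s ≠ 0)
    {t : κ → F} (ht : t ≠ 0)
    (h : ∀ i, t i ≠ 0 → MvPolynomial.aeval (fun j => s j / t i) (P i) = 0) :
    mulHeight t ≤ (Fintype.card (Σ i, (P i).support) : ℝ) ^ totalWeight F *
      mulHeight (fun a : Σ i, (P i).support => algebraMap K F ((P a.1).coeff a.2)) *
        mulHeight s := by
  classical
  -- The coefficients of all the `P i` form a single tuple, so that their contribution at all places
  -- together is one height, and it does not involve `s` or `t`.
  set c : (Σ i, (P i).support) → F := fun a => algebraMap K F ((P a.1).coeff a.2) with hc_def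
  have h0 (i) : (0 : ι →₀ ℕ) ∈ (P i).support := by
    rw [MvPolynomial.mem_support_iff, ← MvPolynomial.constantCoeff_eq, hP]; exact one_ne_zero
  obtain ⟨i₀, _⟩ := Function.ne_iff.mp ht
  have hc : c ≠ 0 := Function.ne_iff.mpr ⟨⟨i₀, 0, h0 i₀⟩, by
    simp only [hc_def, ← MvPolynomial.constantCoeff_eq, hP]; simp⟩
  have : Nonempty κ := ⟨i₀⟩
  have : Nonempty (Σ i, (P i).support) := ⟨⟨i₀, 0, h0 i₀⟩⟩
  set N : ℝ := ((Fintype.card (Σ i, (P i).support) : ℕ) : ℝ) with hN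
  have hN1 : 1 ≤ N := by rw [hN]; exact_mod_cast Fintype.card_pos
  have hB (v : AbsoluteValue F ℝ) (i) (d) :
      v (algebraMap K F ((P i).coeff d)) ≤ ⨆ a, v (c a) := by
    by_cases hd : d ∈ (P i).support
    · exact Finite.le_ciSup (fun a => v (c a)) ⟨i, d, hd⟩
    · rw [MvPolynomial.notMem_support_iff.mp hd, map_zero, map_zero]
      exact Real.iSup_nonneg fun _ => v.nonneg _
  have arch (v : AbsoluteValue F ℝ) :
      ⨆ i, v (t i) ≤ N * ((⨆ a, v (c a)) * ⨆ j, v (s j)) := by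
    refine ciSup_le fun i => ?_
    rw [← mul_assoc]
    refine v.apply_le_of_aeval_div_eq_zero (hP i) (h i) hN1 (hB v i) fun T g r hT hr hg => ?_
    refine (v.sum_le _ _).trans ((Finset.sum_le_card_nsmul _ _ _ hg).trans ?_)
    rw [nsmul_eq_mul]
    refine mul_le_mul_of_nonneg_right (Nat.cast_le.mpr ((Finset.card_le_card hT).trans ?_)) hr
    rw [← Fintype.card_coe]
    exact Fintype.card_le_of_injective (fun d => (⟨i, d⟩ : Σ i, (P i).support))
      (sigma_mk_injective (β := fun i => (P i).support))
  have nonarch (v : nonarchAbsVal (K := F)) :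
      ⨆ i, v.val (t i) ≤ (⨆ a, v.val (c a)) * ⨆ j, v.val (s j) := by
    refine ciSup_le fun i => ?_
    rw [← one_mul (⨆ a, v.val (c a))]
    refine v.val.apply_le_of_aeval_div_eq_zero (hP i) (h i) le_rfl (hB v i)
      fun T g r hT hr hg => ?_
    rw [one_mul]
    rcases T.eq_empty_or_nonempty with rfl | hT'
    · simpa using hr
    · exact ((isNonarchimedean v.val v.2).apply_sum_le_sup hT').trans (Finset.sup'_le _ _ hg)
  -- `totalWeight F` counts the archimedean absolute values with multiplicity, so the power of `N`
  -- gives one factor to each of them and none to the nonarchimedean ones.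
  rw [mulHeight_eq ht, mulHeight_eq hs, mulHeight_eq hc, mul_assoc, mul_mul_mul_comm,
    ← mul_assoc, totalWeight, ← Multiset.prod_replicate, ← Multiset.map_const',
    ← Multiset.prod_map_mul, ← Multiset.prod_map_mul,
    ← finprod_mul_distrib (hasFiniteMulSupport_iSup hc) (hasFiniteMulSupport_iSup hs)]
  refine mul_le_mul (Multiset.prod_map_le_prod_map₀ _ _
    (fun v _ => Real.iSup_nonneg fun _ => v.nonneg _) fun v _ => arch v)
    (finprod_le_finprod (hasFiniteMulSupport_iSup ht)
      (fun v => Real.iSup_nonneg fun _ => v.val.nonneg _)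
      ((hasFiniteMulSupport_iSup hc).mul (hasFiniteMulSupport_iSup hs)) fun v => nonarch v)
    (finprod_nonneg fun v => Real.iSup_nonneg fun _ => v.val.nonneg _)
    (Multiset.prod_map_nonneg fun v _ => ?_)
  have h1 : 0 ≤ ⨆ a, v (c a) := Real.iSup_nonneg fun _ => v.nonneg _
  have h2 : 0 ≤ ⨆ j, v (s j) := Real.iSup_nonneg fun _ => v.nonneg _
  positivity

end Height

/-! ### The absolute naive height over the algebraic closure -/

namespace CanonicalHeight

section NaiveHeight

open Height

variable {K : Type u} [Field K] [NumberField K]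

/-- The field used to define `naiveHeight` varies with the point. Since the height divided by the
degree is unchanged by extension, several points can be compared over one common field. -/
theorem naiveHeight_coe (F : IntermediateField K (AlgebraicClosure K)) [FiniteDimensional K F]
    [NumberField F] {n : ℕ} (y : Fin (n + 1) → F) :
    naiveHeight (fun i => (y i : AlgebraicClosure K)) =
      logHeight y / (Module.finrank ℚ F : ℝ) := by
  set A := IntermediateField.adjoin K (Set.range fun i => (y i : AlgebraicClosure K)) with hA
  have hAF : A ≤ F := by
    rw [hA, IntermediateField.adjoin_le_iff]
    rintro _ ⟨i, rfl⟩
    exact (y i).2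
  have : FiniteDimensional K A := IntermediateField.finiteDimensional_adjoin fun y _ =>
    (Algebra.IsAlgebraic.isAlgebraic (R := K) y).isIntegral
  have : NumberField A := NumberField.of_module_finite K _
  let _ : Algebra A F := (IntermediateField.inclusion hAF).toRingHom.toAlgebra
  exact (NumberField.logHeight_extension_div (F := A) (E := F) fun i =>
    ⟨(y i : AlgebraicClosure K), IntermediateField.subset_adjoin K _ (Set.mem_range_self i)⟩).symm

/-- Finitely many algebraic numbers lie in a common number field. -/
theorem exists_intermediateField (S : Set (AlgebraicClosure K)) (hS : S.Finite) :
    ∃ F : IntermediateField K (AlgebraicClosure K), FiniteDimensional K F ∧ NumberField F ∧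
      ∀ y ∈ S, y ∈ F := by
  have := hS.to_subtype
  have h : FiniteDimensional K (IntermediateField.adjoin K S) :=
    IntermediateField.finiteDimensional_adjoin fun y _ =>
      (Algebra.IsAlgebraic.isAlgebraic (R := K) y).isIntegral
  exact ⟨_, h, NumberField.of_module_finite K _, fun y hy => IntermediateField.subset_adjoin K S hy⟩

theorem exists_lift_two {ι κ : Type*} [Finite ι] [Finite κ] (x : ι → AlgebraicClosure K)
    (y : κ → AlgebraicClosure K) :
    ∃ (F : IntermediateField K (AlgebraicClosure K)) (_ : FiniteDimensional K F)
      (_ : NumberField F) (x' : ι → F) (y' : κ → F),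
      x = (fun i => (x' i : AlgebraicClosure K)) ∧ y = fun i => (y' i : AlgebraicClosure K) := by
  obtain ⟨F, h1, h2, h3⟩ := exists_intermediateField (Set.range x ∪ Set.range y)
    ((Set.finite_range x).union (Set.finite_range y))
  exact ⟨F, h1, h2, fun i => ⟨x i, h3 _ (.inl ⟨i, rfl⟩)⟩, fun i => ⟨y i, h3 _ (.inr ⟨i, rfl⟩)⟩,
    rfl, rfl⟩

theorem naiveHeight_smul {n : ℕ} {c : AlgebraicClosure K} (hc : c ≠ 0)
    (x : Fin (n + 1) → AlgebraicClosure K) : naiveHeight (c • x) = naiveHeight x := by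
  obtain ⟨F, _, _, x', c', rfl, hc'⟩ := exists_lift_two x (fun _ : Unit => c)
  obtain rfl := congrFun hc' ()
  have h : c' () ≠ 0 := by simpa using hc
  rw [naiveHeight_coe F x', ← logHeight_smul_eq_logHeight x' h, ← naiveHeight_coe]
  rfl

/-- The height of the image of a pair of points under the Segre embedding. -/
theorem naiveHeight_segre {n m l : ℕ} (e : Fin (l + 1) ≃ Fin (n + 1) × Fin (m + 1))
    {x : Fin (n + 1) → AlgebraicClosure K} (hx : x ≠ 0)
    {y : Fin (m + 1) → AlgebraicClosure K} (hy : y ≠ 0) :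
    naiveHeight (fun i => x (e i).1 * y (e i).2) = naiveHeight x + naiveHeight y := by
  obtain ⟨F, _, _, x', y', rfl, rfl⟩ := exists_lift_two x y
  have hx' : x' ≠ 0 := by rintro rfl; exact hx (by ext; simp)
  have hy' : y' ≠ 0 := by rintro rfl; exact hy (by ext; simp)
  rw [naiveHeight_coe F x', naiveHeight_coe F y', ← add_div, ← logHeight_fun_mul_eq hx' hy',
    ← logHeight_comp_equiv e, ← naiveHeight_coe]
  rfl

/-- The constant does not depend on the field `F` of the points: after division by `[F : ℚ]`, the
power of `N` contributes `log N`, and the coefficients, which lie in `K`, contribute their height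
over `K`. -/
theorem exists_naiveHeight_le {n m : ℕ} (P : Fin (m + 1) → MvPolynomial (Fin (n + 1)) K)
    (hP : ∀ i, (P i).constantCoeff = 1) :
    ∃ C : ℝ, ∀ (s : Fin (n + 1) → AlgebraicClosure K) (t : Fin (m + 1) → AlgebraicClosure K),
      s ≠ 0 → t ≠ 0 → (∀ i, t i ≠ 0 → MvPolynomial.aeval (fun j => s j / t i) (P i) = 0) →
      naiveHeight t ≤ naiveHeight s + C := by
  set N : ℕ := Fintype.card (Σ i, (P i).support) with hN
  set c : (Σ i, (P i).support) → K := fun a => (P a.1).coeff a.2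
  refine ⟨Real.log N + logHeight c / Module.finrank ℚ K, fun s t hs ht h => ?_⟩
  obtain ⟨F, _, _, s, t, rfl, rfl⟩ := exists_lift_two s t
  have hs' : s ≠ 0 := by rintro rfl; exact hs (by ext; simp)
  have ht' : t ≠ 0 := by rintro rfl; exact ht (by ext; simp)
  have h' : ∀ i, t i ≠ 0 → MvPolynomial.aeval (fun j => s j / t i) (P i) = 0 := fun i hi => by
    have := h i (by simpa using hi)
    have e : (fun j => (s j : AlgebraicClosure K) / t i) = fun j => algebraMap F _ (s j / t i) :=
      funext fun j => by simp
    rw [e] at this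
    exact (map_eq_zero (algebraMap F (AlgebraicClosure K))).mp
      ((MvPolynomial.aeval_algebraMap_apply _ _ _).symm.trans this)
  have key := mulHeight_le_of_aeval_div_eq_zero P hP hs' ht' h'
  have hN0 : 0 < N := by
    rw [hN, Fintype.card_pos_iff]
    refine ⟨⟨0, 0, ?_⟩⟩
    rw [MvPolynomial.mem_support_iff, ← MvPolynomial.constantCoeff_eq, hP]; exact one_ne_zero
  have hN0' : (0 : ℝ) < N := Nat.cast_pos.mpr hN0
  have key2 := Real.log_le_log (mulHeight_pos t) key
  have hd : (0 : ℝ) < Module.finrank ℚ F := Nat.cast_pos.mpr Module.finrank_pos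
  rw [Real.log_mul (mul_pos (pow_pos hN0' _) (mulHeight_pos _)).ne' (mulHeight_pos _).ne',
    Real.log_mul (pow_pos hN0' _).ne' (mulHeight_pos _).ne', Real.log_pow,
    NumberField.totalWeight_eq_finrank, ← logHeight_eq_log_mulHeight,
    ← logHeight_eq_log_mulHeight, ← logHeight_eq_log_mulHeight] at key2
  rw [naiveHeight_coe F t, naiveHeight_coe F s,
    ← NumberField.logHeight_extension_div (F := K) (E := F)]
  have := div_le_div_of_nonneg_right key2 hd.le
  rw [add_div, add_div, mul_div_cancel_left₀ _ hd.ne'] at this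
  linarith

end NaiveHeight

end CanonicalHeight

/-! ### A valuative criterion for integral equations -/

/-- A valuative criterion for elements `u j` of a `K`-algebra to satisfy a polynomial equation
with nonzero constant coefficient. -/
theorem MvPolynomial.exists_aeval_eq_zero_of_valuationSubring {K : Type u} [Field K] {R : Type u}
    [CommRing R] [Algebra K R] {ι : Type*} (u : ι → R)
    (H : ∀ (E : Type u) [Field E] (φ : R →+* E) (V : ValuationSubring E),
      (∀ a : K, φ (algebraMap K R a) ∈ V) → ∃ j, ∀ h : φ (u j) ∈ V,
        (⟨φ (u j), h⟩ : V) ∉ IsLocalRing.maximalIdeal V) :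
    ∃ P : MvPolynomial ι K, P.constantCoeff = 1 ∧ aeval u P = 0 := by
  set J := RingHom.ker (aeval (R := K) u).toRingHom with hJ
  set I := RingHom.ker (constantCoeff (R := K) (σ := ι)) with hI
  have hImax : I.IsMaximal :=
    RingHom.ker_isMaximal_of_surjective _ fun a => ⟨C a, constantCoeff_C _ a⟩
  -- `J` consists of the relations between the `u j`, and `I` is the maximal ideal of the origin. If
  -- `J` is not inside `I`, then `J + I = 1`, and a relation with constant coefficient `1` exists.
  by_cases hJI : J ≤ I
  swap
  · have h1 : J ⊔ I = ⊤ := by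
      rw [sup_comm]
      exact hImax.1.2 _ (left_lt_sup.mpr hJI)
    obtain ⟨a, ha, b, hb, hab⟩ := Submodule.mem_sup.mp
      (h1 ▸ Submodule.mem_top : (1 : MvPolynomial ι K) ∈ J ⊔ I)
    refine ⟨a, ?_, ha⟩
    have := congrArg constantCoeff hab
    rwa [map_add, RingHom.mem_ker.mp hb, add_zero, map_one] at this
  exfalso
  have := hImax.isPrime
  -- Otherwise the origin lies in the closure of the image of `Spec R`. Minimal primes over the
  -- kernel `J` are contracted from `R`, so a single point `Q` of `Spec R` already specialises to
  -- the origin.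
  obtain ⟨q, hq, hqI⟩ := Ideal.exists_minimalPrimes_le hJI
  obtain ⟨Q, hQ, -, hQq⟩ := Ideal.exists_comap_eq_of_mem_minimalPrimes (I := (⊥ : Ideal R))
    (aeval (R := K) u).toRingHom q hq
  let φ : R →+* Q.ResidueField := algebraMap R Q.ResidueField
  let ψ : MvPolynomial ι K →+* Q.ResidueField := φ.comp (aeval (R := K) u).toRingHom
  have hker : RingHom.ker ψ = q := by
    rw [← hQq, ← RingHom.comap_ker, Ideal.ker_algebraMap_residueField]
  have hsurj : Function.Surjective ψ.rangeRestrict := ψ.rangeRestrict_surjective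
  have hker' : RingHom.ker ψ.rangeRestrict ≤ I := by
    rw [RingHom.ker_rangeRestrict, hker]; exact hqI
  have hprime : (I.map ψ.rangeRestrict).IsPrime := Ideal.map_isPrime_of_surjective hsurj hker'
  -- A valuation ring of the residue field of `Q` dominates the local ring of the origin. All `u j`
  -- then fall into its maximal ideal, against `H`.
  obtain ⟨V, hV⟩ := LocalSubring.exists_le_valuationSubring
    (LocalSubring.ofPrime ψ.range (I.map ψ.rangeRestrict))
  obtain ⟨hV1, hV2⟩ := hV
  have hle := (LocalSubring.le_ofPrime ψ.range (I.map ψ.rangeRestrict)).trans hV1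
  obtain ⟨j, hj⟩ := H Q.ResidueField φ V fun a => hle ⟨C a, by simp [ψ]⟩
  have hψX : ψ (X j) = φ (u j) := by simp [ψ]
  have hmem : φ (u j) ∈ ψ.range := ⟨X j, hψX⟩
  refine hj (hle hmem) ?_
  rw [IsLocalRing.mem_maximalIdeal, mem_nonunits_iff]
  intro hu
  have hu2 := hV2.map_nonunit
    (⟨φ (u j), LocalSubring.le_ofPrime ψ.range (I.map ψ.rangeRestrict) hmem⟩ :
      (LocalSubring.ofPrime ψ.range (I.map ψ.rangeRestrict)).toSubring) hu
  have hIm : (⟨φ (u j), hmem⟩ : ψ.range) ∈ I.map ψ.rangeRestrict := by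
    have : ψ.rangeRestrict (X j) = ⟨φ (u j), hmem⟩ := Subtype.ext hψX
    rw [← this]
    exact Ideal.mem_map_of_mem _ (by rw [hI, RingHom.mem_ker, constantCoeff_X])
  have := (IsLocalization.AtPrime.isUnit_to_map_iff
    (LocalSubring.ofPrime ψ.range (I.map ψ.rangeRestrict)).toSubring
    (I.map ψ.rangeRestrict) ⟨φ (u j), hmem⟩).mp hu2
  exact this hIm

noncomputable section

namespace CanonicalHeight

/-! ### Evaluation of functions at ring-valued points -/

section Evaluation

variable {X Y : Scheme.{u}} {R S : Type u} [CommRing R] [CommRing S]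

/-- Evaluation of functions at an `R`-valued point of a scheme. -/
def ev (x : Spec (CommRingCat.of R) ⟶ X) {U : X.Opens} (h : ⊤ ≤ x ⁻¹ᵁ U) : Γ(X, U) →+* R :=
  (x.appLE U ⊤ h ≫ (Scheme.ΓSpecIso (CommRingCat.of R)).hom).hom

theorem ev_map (x : Spec (CommRingCat.of R) ⟶ X) {U V : X.Opens} (i : U ⟶ V)
    (h : ⊤ ≤ x ⁻¹ᵁ U) (a : Γ(X, V)) :
    ev x h (X.presheaf.map i.op a) = ev x (h.trans (x.preimage_mono i.le)) a := by
  simp only [ev]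
  rw [← CommRingCat.comp_apply, Scheme.Hom.map_appLE_assoc]

theorem ev_SpecMap (x : Spec (CommRingCat.of R) ⟶ X) (φ : R →+* S) {U : X.Opens}
    (h : ⊤ ≤ x ⁻¹ᵁ U) (h' : ⊤ ≤ (Spec.map (CommRingCat.ofHom φ) ≫ x) ⁻¹ᵁ U) (a : Γ(X, U)) :
    ev (Spec.map (CommRingCat.ofHom φ) ≫ x) h' a = φ (ev x h a) := by
  simp only [ev]
  rw [← Scheme.Hom.appLE_comp_appLE (Spec.map (CommRingCat.ofHom φ)) x U ⊤ ⊤ h le_top,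
    Category.assoc]
  have : (Spec.map (CommRingCat.ofHom φ)).appLE ⊤ ⊤ le_top ≫ (Scheme.ΓSpecIso _).hom =
      (Scheme.ΓSpecIso _).hom ≫ CommRingCat.ofHom φ :=
    (congrArg (· ≫ _) (Scheme.Hom.appLE_eq_app _)).trans
      (Scheme.ΓSpecIso_naturality (CommRingCat.ofHom φ))
  rw [this]
  rfl

theorem ev_comp (x : Spec (CommRingCat.of R) ⟶ X) (f : X ⟶ Y) {U : Y.Opens}
    (h : ⊤ ≤ x ⁻¹ᵁ f ⁻¹ᵁ U) (h' : ⊤ ≤ (x ≫ f) ⁻¹ᵁ U) (a : Γ(Y, U)) :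
    ev (x ≫ f) h' a = ev x h (f.app U a) := by
  simp only [ev]
  rw [Scheme.Hom.comp_appLE]
  rfl

theorem top_le_preimage [IsLocalRing R] {x : Spec (CommRingCat.of R) ⟶ X} {U : X.Opens}
    (h : x (IsLocalRing.closedPoint R) ∈ U) : ⊤ ≤ x ⁻¹ᵁ U :=
  (Scheme.preimage_eq_top_of_closedPoint_mem x h).ge

theorem top_le_preimage_inf {x : Spec (CommRingCat.of R) ⟶ X} {U V : X.Opens}
    (hU : ⊤ ≤ x ⁻¹ᵁ U) (hV : ⊤ ≤ x ⁻¹ᵁ V) : ⊤ ≤ x ⁻¹ᵁ (U ⊓ V) :=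
  le_inf hU hV

/-- Unlike `value`, `ev` makes sense over any ring, in particular over the valuation rings used for
integrality. -/
theorem value_eq_ev {E : Type u} [Field E] (x : Spec (CommRingCat.of E) ⟶ X) {U : X.Opens}
    (hx : x (IsLocalRing.closedPoint E) ∈ U) (a : Γ(X, U)) :
    value x hx a = ev x (top_le_preimage hx) a := by
  simp only [value, ev]
  rw [← CommRingCat.comp_apply, Scheme.germ_stalkClosedPointTo]
  simp only [Iso.trans_hom, Functor.mapIso_hom, Scheme.Hom.appLE]
  rfl

theorem isUnit_ev_iff [IsLocalRing R] (x : Spec (CommRingCat.of R) ⟶ X) {U : X.Opens}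
    (h : ⊤ ≤ x ⁻¹ᵁ U) (a : Γ(X, U)) :
    IsUnit (ev x h a) ↔ x (IsLocalRing.closedPoint R) ∈ X.basicOpen a := by
  have h1 := Scheme.basicOpen_appLE x ⊤ U h a
  rw [top_inf_eq, basicOpen_eq_of_affine'] at h1
  have h2 : x (IsLocalRing.closedPoint R) ∈ X.basicOpen a ↔ IsLocalRing.closedPoint R ∈
      PrimeSpectrum.basicOpen ((Scheme.ΓSpecIso (CommRingCat.of R)).hom (x.appLE U ⊤ h a)) :=
    (SetLike.ext_iff.mp h1 (IsLocalRing.closedPoint R)).symm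
  exact (IsLocalRing.notMem_maximalIdeal (R := R)).symm.trans h2.symm

theorem ev_ne_zero_iff {E : Type u} [Field E] (x : Spec (CommRingCat.of E) ⟶ X) {U : X.Opens}
    (h : ⊤ ≤ x ⁻¹ᵁ U) (a : Γ(X, U)) :
    ev x h a ≠ 0 ↔ x (IsLocalRing.closedPoint E) ∈ X.basicOpen a := by
  rw [← isUnit_ev_iff x h, isUnit_iff_ne_zero]

theorem ev_unit_ne_zero {E : Type u} [Field E] (x : Spec (CommRingCat.of E) ⟶ X) {U : X.Opens}
    (h : ⊤ ≤ x ⁻¹ᵁ U) (a : Γ(X, U)ˣ) : ev x h (a : Γ(X, U)) ≠ 0 :=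
  (a.isUnit.map (ev x h)).ne_zero

end Evaluation

/-! ### Heights attached to generated bundles -/

namespace LineBundle.GlobalSection

variable {X : Scheme.{u}} {L : LineBundle X}

/-- The transformation of the value of a section under a change of trivialisation. -/
theorem ev_eq {R : Type u} [CommRing R] (s : L.GlobalSection) (x : Spec (CommRingCat.of R) ⟶ X)
    {i j : L.ι} (hi : ⊤ ≤ x ⁻¹ᵁ L.U i) (hj : ⊤ ≤ x ⁻¹ᵁ L.U j) :
    ev x hi (s.s i) = ev x (top_le_preimage_inf hi hj) (L.g i j : Γ(X, L.U i ⊓ L.U j)) *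
      ev x hj (s.s j) := by
  have := congrArg (ev x (top_le_preimage_inf hi hj)) (s.compat i j)
  rwa [map_mul, ev_map, ev_map] at this

end LineBundle.GlobalSection

/-- The morphism of schemes underlying a geometric point. -/
abbrev GeomPoint.pt {K : Type u} [Field K] {X : Over (Spec (CommRingCat.of K))}
    (x : GeomPoint X) : Spec (CommRingCat.of (AlgebraicClosure K)) ⟶ X.left :=
  x.left

namespace GeneratedBundle

variable {K : Type u} [Field K] {X : Scheme.{u}}

theorem exists_ev_ne_zero (G : GeneratedBundle X) {E : Type u} [Field E]
    (x : Spec (CommRingCat.of E) ⟶ X) {i : G.L.ι} (hi : ⊤ ≤ x ⁻¹ᵁ G.L.U i) :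
    (fun j => ev x hi ((G.s j).s i)) ≠ 0 := by
  obtain ⟨j, i', h⟩ := G.generate (x (IsLocalRing.closedPoint E))
  have hi' := top_le_preimage (X.basicOpen_le _ h)
  refine Function.ne_iff.mpr ⟨j, ?_⟩
  rw [(G.s j).ev_eq x hi hi']
  exact mul_ne_zero (ev_unit_ne_zero _ _ _) ((ev_ne_zero_iff x hi' _).mpr h)

variable [NumberField K] {X Y : Over (Spec (CommRingCat.of K))}

/-- The height may be computed in any trivialisation around the point. -/
theorem height_eq (G : GeneratedBundle X.left) (x : GeomPoint X) {i : G.L.ι}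
    (hi : ⊤ ≤ x.pt ⁻¹ᵁ G.L.U i) :
    G.height x = naiveHeight fun j => ev x.pt hi ((G.s j).s i) := by
  have h0 := (G.L.cover (x.pt (IsLocalRing.closedPoint (AlgebraicClosure K)))).choose_spec
  have h1 : G.height x = naiveHeight fun j => ev x.pt (top_le_preimage h0) ((G.s j).s _) :=
    congrArg naiveHeight (funext fun j => value_eq_ev x.pt h0 _)
  have h2 : (fun j => ev x.pt (top_le_preimage h0) ((G.s j).s _)) =
      ev x.pt (top_le_preimage_inf (top_le_preimage h0) hi) (G.L.g _ i).1 •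
        fun j => ev x.pt hi ((G.s j).s i) :=
    funext fun j => (G.s j).ev_eq x.pt _ _
  rw [h1, h2, naiveHeight_smul (ev_unit_ne_zero _ _ _)]

end GeneratedBundle

/-! ### Restriction, pullback and tensor products of sections -/

section Restriction

variable {X Y : Scheme.{u}}

/-- Restriction of functions from `V` to a smaller open set `U`. -/
def rest {U V : X.Opens} (h : U ≤ V) : Γ(X, V) →+* Γ(X, U) :=
  (X.presheaf.map (homOfLE h).op).hom

theorem rest_rest {U V W : X.Opens} (h : U ≤ V) (h' : V ≤ W) (a : Γ(X, W)) :
    rest h (rest h' a) = rest (h.trans h') a := by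
  simp only [rest]
  rw [← CommRingCat.comp_apply, ← Functor.map_comp, ← op_comp, homOfLE_comp]

theorem coe_res {U V : X.Opens} (h : U ≤ V) (a : Γ(X, V)ˣ) :
    (res h a : Γ(X, U)) = rest h (a : Γ(X, V)) := rfl

theorem app_rest (f : X ⟶ Y) {U V : Y.Opens} (h : U ≤ V) (a : Γ(Y, V)) :
    f.app U (rest h a) = rest (f.preimage_mono h) (f.app V a) := by
  simp only [rest]
  rw [← CommRingCat.comp_apply, ← CommRingCat.comp_apply, f.naturality]
  rfl

theorem basicOpen_rest {U V : X.Opens} (h : U ≤ V) (a : Γ(X, V)) :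
    X.basicOpen (rest h a) = U ⊓ X.basicOpen a :=
  X.basicOpen_res a (homOfLE h).op

theorem ev_rest {R : Type u} [CommRing R] (x : Spec (CommRingCat.of R) ⟶ X) {U V : X.Opens}
    (i : U ≤ V) (h : ⊤ ≤ x ⁻¹ᵁ U) (a : Γ(X, V)) :
    ev x h (rest i a) = ev x (h.trans (x.preimage_mono i)) a :=
  ev_map x (homOfLE i) h a

end Restriction

namespace LineBundle.GlobalSection

variable {X Y : Scheme.{u}} {L M : LineBundle X}

theorem compat_rest (s : L.GlobalSection) {V : X.Opens} {i j : L.ι} (h : V ≤ L.U i ⊓ L.U j) :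
    rest (h.trans inf_le_left) (s.s i) =
      (res h (L.g i j) : Γ(X, V)) * rest (h.trans inf_le_right) (s.s j) := by
  have := congrArg (rest h) (s.compat i j)
  rw [map_mul] at this
  have e1 := rest_rest h inf_le_left (s.s i)
  have e2 := rest_rest h inf_le_right (s.s j)
  rw [← e1, ← e2]
  exact this

/-- The pullback of a global section. -/
def pullback (f : X ⟶ Y) {L : LineBundle Y} (s : L.GlobalSection) :
    (L.pullback f).GlobalSection where
  s i := f.app _ (s.s i)
  compat i j := by
    have := congrArg (f.app _) (s.compat i j)
    rw [map_mul] at this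
    exact (app_rest f inf_le_left (s.s i)).symm.trans
      (this.trans (congrArg (_ * ·) (app_rest f inf_le_right (s.s j))))

/-- The tensor product of two global sections. -/
def tensor (s : L.GlobalSection) (t : M.GlobalSection) : (L.tensor M).GlobalSection where
  s i := rest inf_le_left (s.s i.1) * rest inf_le_right (t.s i.2)
  compat i j := by
    refine (map_mul (rest (X := X) inf_le_left) _ _).trans
      ((congrArg₂ (· * ·) (rest_rest _ _ _) (rest_rest _ _ _)).trans ?_)
    refine Eq.trans ?_ (congrArg (_ * ·) ((map_mul (rest (X := X) inf_le_right) _ _).trans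
      (congrArg₂ (· * ·) (rest_rest _ _ _) (rest_rest _ _ _)))).symm
    have e1 := s.compat_rest (V := (L.tensor M).U i ⊓ (L.tensor M).U j)
      (inf_le_inf inf_le_left inf_le_left)
    have e2 := t.compat_rest (V := (L.tensor M).U i ⊓ (L.tensor M).U j)
      (inf_le_inf inf_le_right inf_le_right)
    exact (congrArg₂ (· * ·) e1 e2).trans (mul_mul_mul_comm _ _ _ _)

end LineBundle.GlobalSection

namespace GeneratedBundle

section

variable {X Y : Scheme.{u}}

/-- The pullback of a generated bundle along a morphism. -/
def pullback (f : X ⟶ Y) (G : GeneratedBundle Y) : GeneratedBundle X where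
  L := G.L.pullback f
  n := G.n
  s j := (G.s j).pullback f
  generate p := by
    obtain ⟨j, i, h⟩ := G.generate (f p)
    refine ⟨j, i, ?_⟩
    have h' : p ∈ f ⁻¹ᵁ Y.basicOpen ((G.s j).s i) := h
    rwa [Scheme.preimage_basicOpen] at h'

/-- The enumeration of the coordinates of the Segre embedding. -/
def segreEquiv (n m : ℕ) : Fin ((n + 1) * (m + 1) - 1 + 1) ≃ Fin (n + 1) × Fin (m + 1) :=
  (finCongr (Nat.sub_add_cancel (Nat.mul_pos n.succ_pos m.succ_pos))).trans finProdFinEquiv.symm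

/-- The tensor product of two generated bundles. -/
def tensor (G H : GeneratedBundle X) : GeneratedBundle X where
  L := G.L.tensor H.L
  n := (G.n + 1) * (H.n + 1) - 1
  s j := (G.s (segreEquiv G.n H.n j).1).tensor (H.s (segreEquiv G.n H.n j).2)
  generate p := by
    obtain ⟨j, i, h⟩ := G.generate p
    obtain ⟨j', i', h'⟩ := H.generate p
    refine ⟨(segreEquiv G.n H.n).symm (j, j'), (i, i'), ?_⟩
    rw [Equiv.apply_symm_apply]
    simp only [LineBundle.GlobalSection.tensor]
    refine (SetLike.ext_iff.mp (X.basicOpen_mul _ _) p).mpr ⟨?_, ?_⟩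
    · exact (SetLike.ext_iff.mp (basicOpen_rest _ _) p).mpr
        ⟨⟨X.basicOpen_le _ h, X.basicOpen_le _ h'⟩, h⟩
    · exact (SetLike.ext_iff.mp (basicOpen_rest _ _) p).mpr
        ⟨⟨X.basicOpen_le _ h, X.basicOpen_le _ h'⟩, h'⟩

end

theorem exists_trivialisation {K : Type u} [Field K] {X : Over (Spec (CommRingCat.of K))}
    (G : GeneratedBundle X.left) (x : GeomPoint X) : ∃ i, ⊤ ≤ x.pt ⁻¹ᵁ G.L.U i := by
  obtain ⟨i, hi⟩ := G.L.cover (x.pt (IsLocalRing.closedPoint (AlgebraicClosure K)))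
  exact ⟨i, top_le_preimage hi⟩

variable {K : Type u} [Field K] [NumberField K] {X Y : Over (Spec (CommRingCat.of K))}

theorem height_pullback (f : X ⟶ Y) (G : GeneratedBundle Y.left) (x : GeomPoint X) :
    (G.pullback f.left).height x = G.height (x ≫ f) := by
  obtain ⟨i, hi⟩ := G.exists_trivialisation (x ≫ f)
  rw [G.height_eq (x ≫ f) hi, (G.pullback f.left).height_eq (i := i) x hi]
  exact congrArg naiveHeight (funext fun j => (ev_comp x.pt f.left _ _ _).symm)

theorem height_tensor (G H : GeneratedBundle X.left) (x : GeomPoint X) :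
    (G.tensor H).height x = G.height x + H.height x := by
  obtain ⟨i, hi⟩ := G.exists_trivialisation x
  obtain ⟨i', hi'⟩ := H.exists_trivialisation x
  rw [G.height_eq x hi, H.height_eq x hi',
    (G.tensor H).height_eq x (i := (i, i')) (top_le_preimage_inf hi hi'),
    ← naiveHeight_segre (segreEquiv G.n H.n) (G.exists_ev_ne_zero x.pt hi)
      (H.exists_ev_ne_zero x.pt hi')]
  exact congrArg naiveHeight (funext fun j => (map_mul (ev x.pt _) _ _).trans
    (congrArg₂ (· * ·) (ev_rest _ _ _ _) (ev_rest _ _ _ _)))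

/-- Generated bundles with isomorphic line bundles may be replaced by sections of one and the
same line bundle. -/
theorem exists_common_bundle (G H : GeneratedBundle X.left) (h : G.L ≈ H.L) :
    ∃ G' H' : GeneratedBundle X.left, (∀ x : GeomPoint X, G'.height x = G.height x) ∧
      (∀ x : GeomPoint X, H'.height x = H.height x) ∧
      ∃ (L : LineBundle X.left) (n m : ℕ) (s : Fin (n + 1) → L.GlobalSection)
        (t : Fin (m + 1) → L.GlobalSection) (hs : _) (ht : _),
        G' = ⟨L, n, s, hs⟩ ∧ H' = ⟨L, m, t, ht⟩ := by
  obtain ⟨κ, W, hW, α, β, hα, hβ, h, hh⟩ := h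
  -- The common bundle is `H.L` on the refined cover. The sections of `G` are carried over by the
  -- isomorphism `h`, which multiplies the coordinates at a point by a common unit and so preserves
  -- heights.
  let L : LineBundle X.left :=
    { ι := κ
      U := W
      cover := hW
      g := fun a b => res (inf_le_inf (hβ a) (hβ b)) (H.L.g (β a) (β b))
      cocycle := fun a b c => by
        simp only [res_res]
        rw [H.L.cocycle_res] }
  let s : Fin (G.n + 1) → L.GlobalSection := fun j =>
    { s := fun a => h a * rest (hα a) ((G.s j).s (α a))
      compat := fun a b => by
        have e := (G.s j).compat_rest (V := W a ⊓ W b) (inf_le_inf (hα a) (hα b))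
        have e' := congrArg Units.val (hh a b)
        refine (map_mul (rest inf_le_left) _ _).trans ?_
        refine Eq.trans ?_ (congrArg (_ * ·) (map_mul (rest inf_le_right) _ _)).symm
        rw [rest_rest, rest_rest, ← mul_assoc]
        refine (congrArg (_ * ·) e).trans ?_
        rw [← mul_assoc]
        exact congrArg (· * _) e' }
  let t : Fin (H.n + 1) → L.GlobalSection := fun j =>
    { s := fun a => rest (hβ a) ((H.s j).s (β a))
      compat := fun a b => by
        have e := (H.s j).compat_rest (V := W a ⊓ W b) (inf_le_inf (hβ a) (hβ b))
        refine (rest_rest _ _ _).trans (e.trans ?_)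
        exact congrArg (_ * ·) (rest_rest _ _ _).symm }
  have hs : ∀ p : X.left, ∃ j i, p ∈ X.left.basicOpen ((s j).s i) := fun p => by
    obtain ⟨a, ha⟩ := hW p
    obtain ⟨j, i, hji⟩ := G.generate p
    have hp : p ∈ G.L.U i ⊓ G.L.U (α a) := ⟨X.left.basicOpen_le _ hji, hα a ha⟩
    have e := (G.s j).compat_rest (V := G.L.U i ⊓ G.L.U (α a)) le_rfl
    have h1 : p ∈ X.left.basicOpen
        (rest inf_le_left ((G.s j).s i) : Γ(X.left, G.L.U i ⊓ G.L.U (α a))) := by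
      rw [basicOpen_rest]; exact ⟨hp, hji⟩
    rw [e, X.left.basicOpen_mul, basicOpen_rest] at h1
    refine ⟨j, a, ?_⟩
    refine (SetLike.ext_iff.mp (X.left.basicOpen_mul _ _) p).mpr ⟨?_, ?_⟩
    · rw [X.left.basicOpen_of_isUnit (h a).isUnit]; exact ha
    · rw [basicOpen_rest]; exact ⟨ha, h1.2.2⟩
  have ht : ∀ p : X.left, ∃ j i, p ∈ X.left.basicOpen ((t j).s i) := fun p => by
    obtain ⟨a, ha⟩ := hW p
    obtain ⟨j, i, hji⟩ := H.generate p
    have hp : p ∈ H.L.U i ⊓ H.L.U (β a) := ⟨X.left.basicOpen_le _ hji, hβ a ha⟩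
    have e := (H.s j).compat_rest (V := H.L.U i ⊓ H.L.U (β a)) le_rfl
    have h1 : p ∈ X.left.basicOpen
        (rest inf_le_left ((H.s j).s i) : Γ(X.left, H.L.U i ⊓ H.L.U (β a))) := by
      rw [basicOpen_rest]; exact ⟨hp, hji⟩
    rw [e, X.left.basicOpen_mul, basicOpen_rest] at h1
    refine ⟨j, a, ?_⟩
    rw [basicOpen_rest]; exact ⟨ha, h1.2.2⟩
  refine ⟨⟨L, G.n, s, hs⟩, ⟨L, H.n, t, ht⟩, fun x => ?_, fun x => ?_, L, G.n, H.n, s, t, hs, ht,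
    rfl, rfl⟩
  · obtain ⟨a, ha⟩ := exists_trivialisation ⟨L, G.n, s, hs⟩ x
    rw [height_eq ⟨L, G.n, s, hs⟩ x ha, G.height_eq x (ha.trans (x.pt.preimage_mono (hα a)))]
    have : (fun j => ev x.pt ha ((s j).s a)) = ev x.pt (U := W a) ha (h a).1 •
        fun j => ev x.pt (ha.trans (x.pt.preimage_mono (hα a))) ((G.s j).s (α a)) :=
      funext fun j => (map_mul (ev x.pt _) _ _).trans (congrArg (_ * ·) (ev_rest _ _ _ _))
    exact (congrArg naiveHeight this).trans (naiveHeight_smul (ev_unit_ne_zero _ _ _) _)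
  · obtain ⟨a, ha⟩ := exists_trivialisation ⟨L, H.n, t, ht⟩ x
    rw [height_eq ⟨L, H.n, t, ht⟩ x ha, H.height_eq x (ha.trans (x.pt.preimage_mono (hβ a)))]
    exact congrArg naiveHeight (funext fun j => ev_rest _ _ _ _)

end GeneratedBundle

/-! ### Properness of projective schemes -/

section Proper

attribute [local instance] MvPolynomial.gradedAlgebra

/-- `Proj` of an algebra of finite type over its degree-zero part is proper over the spectrum of
that part, which here is `K` itself. -/
instance (K : Type u) [Field K] (n : ℕ) : IsProper (projectiveSpace K n).hom := by
  have : IsScalarTower K (MvPolynomial.homogeneousSubmodule (Fin (n + 1)) K 0)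
      (MvPolynomial (Fin (n + 1)) K) :=
    ⟨fun a b c => smul_mul_assoc a (b : MvPolynomial (Fin (n + 1)) K) c⟩
  have : Algebra.FiniteType (MvPolynomial.homogeneousSubmodule (Fin (n + 1)) K 0)
      (MvPolynomial (Fin (n + 1)) K) :=
    Algebra.FiniteType.of_restrictScalars_finiteType K _ _
  have : IsIso (Spec.map (CommRingCat.ofHom
      (algebraMap K (MvPolynomial.homogeneousSubmodule (Fin (n + 1)) K 0)))) := by
    rw [isIso_SpecMap_iff]
    change Function.Bijective (algebraMap K (MvPolynomial.homogeneousSubmodule (Fin (n + 1)) K 0))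
    refine ⟨fun a b h => MvPolynomial.C_injective _ _ (congrArg Subtype.val h), fun y => ?_⟩
    have hy : (y : MvPolynomial (Fin (n + 1)) K) ∈ (1 : Submodule K _) :=
      (SetLike.ext_iff.mp (MvPolynomial.homogeneousSubmodule_zero _) _).mp y.2
    obtain ⟨a, ha⟩ := Submodule.mem_one.mp hy
    exact ⟨a, Subtype.ext ha⟩
  exact inferInstanceAs (IsProper (Proj.toSpecZero _ ≫ Spec.map _))

theorem IsProjective.isProper {K : Type u} [Field K] {X : Over (Spec (CommRingCat.of K))}
    (hX : IsProjective X) : IsProper X.hom := by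
  obtain ⟨n, j, hj⟩ := hX
  rw [← Over.w j]
  infer_instance

end Proper

/-! ### Constant functions and points of affine open sets -/

section Scalars

variable {K : Type u} [Field K] {X : Over (Spec (CommRingCat.of K))}

/-- The constant functions on an open subset of a `K`-scheme. -/
def scalars (W : X.left.Opens) : K →+* Γ(X.left, W) :=
  ((Scheme.ΓSpecIso (CommRingCat.of K)).inv ≫ X.hom.appLE ⊤ W le_top).hom

theorem ev_scalars {R : Type u} [CommRing R] (x : Spec (CommRingCat.of R) ⟶ X.left) (ρ : K →+* R)
    (hx : x ≫ X.hom = Spec.map (CommRingCat.ofHom ρ)) {W : X.left.Opens} (h : ⊤ ≤ x ⁻¹ᵁ W)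
    (a : K) : ev x h (scalars W a) = ρ a := by
  have h1 : X.hom.appLE ⊤ W le_top ≫ x.appLE W ⊤ h = (x ≫ X.hom).appLE ⊤ ⊤ le_top :=
    Scheme.Hom.appLE_comp_appLE _ _ _ _ _ _ _
  have h2 : (Spec.map (CommRingCat.ofHom ρ)).appLE ⊤ ⊤ le_top ≫ (Scheme.ΓSpecIso _).hom =
      (Scheme.ΓSpecIso _).hom ≫ CommRingCat.ofHom ρ :=
    (congrArg (· ≫ _) (Scheme.Hom.appLE_eq_app _)).trans
      (Scheme.ΓSpecIso_naturality (CommRingCat.ofHom ρ))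
  have h3 : ((Scheme.ΓSpecIso (CommRingCat.of K)).inv ≫ X.hom.appLE ⊤ W le_top) ≫
      x.appLE W ⊤ h ≫ (Scheme.ΓSpecIso (CommRingCat.of R)).hom = CommRingCat.ofHom ρ := by
    rw [Category.assoc, reassoc_of% h1]
    simp only [hx]
    rw [h2, Iso.inv_hom_id_assoc]
  exact congrArg (fun f => f.hom a) h3

theorem fromSpec_comp_hom {W : X.left.Opens} (hW : IsAffineOpen W) :
    hW.fromSpec ≫ X.hom = Spec.map (CommRingCat.ofHom (scalars W)) := by
  have := IsAffineOpen.SpecMap_appLE_fromSpec X.hom (isAffineOpen_top _) hW le_top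
  rw [← this, IsAffineOpen.fromSpec_top, Scheme.isoSpec_Spec_inv, ← Spec.map_comp]
  rfl

theorem ev_fromSpec {X : Scheme.{u}} {W : X.Opens} (hW : IsAffineOpen W) {R : Type u}
    [CommRing R] (φ : Γ(X, W) →+* R)
    (h : ⊤ ≤ (Spec.map (CommRingCat.ofHom φ) ≫ hW.fromSpec) ⁻¹ᵁ W) (a : Γ(X, W)) :
    ev (Spec.map (CommRingCat.ofHom φ) ≫ hW.fromSpec) h a = φ a := by
  have h0 : ⊤ ≤ hW.fromSpec ⁻¹ᵁ W := hW.fromSpec_preimage_self.ge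
  refine (ev_SpecMap (R := Γ(X, W)) hW.fromSpec φ h0 h a).trans (congrArg φ ?_)
  have : hW.fromSpec.appLE W ⊤ h0 ≫ (Scheme.ΓSpecIso _).hom = 𝟙 _ := by
    rw [Scheme.Hom.appLE, hW.fromSpec_app_self, Category.assoc, Category.assoc,
      ← Functor.map_comp_assoc, Iso.inv_comp_eq, Category.comp_id]
    refine (congrArg (· ≫ _) ?_).trans (Category.id_comp _)
    exact (congrArg _ (Subsingleton.elim _ (𝟙 _))).trans ((Spec Γ(X, W)).presheaf.map_id _)
  exact congrArg (fun f => f.hom a) this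

end Scalars

/-! ### Integrality of a section over generating sections -/

section Integrality

variable {K : Type u} [Field K] {X : Over (Spec (CommRingCat.of K))} {L : LineBundle X.left}

/-- On a proper scheme, a section `t` does not become infinite compared with generating sections
`s j`, at valuation rings. -/
theorem exists_notMem_maximalIdeal [IsProper X.hom] {n : ℕ} {s : Fin (n + 1) → L.GlobalSection}
    (hs : ∀ p : X.left, ∃ j i, p ∈ X.left.basicOpen ((s j).s i)) (t : L.GlobalSection)
    {E : Type u} [Field E] (V : ValuationSubring E) (x : Spec (CommRingCat.of E) ⟶ X.left)
    (ρ : K →+* V) (hx : x ≫ X.hom = Spec.map (CommRingCat.ofHom ((algebraMap V E).comp ρ)))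
    {i : L.ι} (hi : ⊤ ≤ x ⁻¹ᵁ L.U i) (u : Fin (n + 1) → E)
    (hu : ∀ j, u j * ev x hi (t.s i) = ev x hi ((s j).s i)) :
    ∃ j, ∀ h : u j ∈ V, (⟨u j, h⟩ : V) ∉ IsLocalRing.maximalIdeal V := by
  have hexist : ValuativeCriterion.Existence X.hom := by
    have : UniversallyClosed X.hom := inferInstance
    rw [UniversallyClosed.eq_valuativeCriterion] at this
    exact this.1
  have hsq : CommSq x (Spec.map (CommRingCat.ofHom (algebraMap V E))) X.hom
      (Spec.map (CommRingCat.ofHom ρ)) := ⟨by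
    rw [hx, ← Spec.map_comp]
    rfl⟩
  -- Properness enters here: the `E`-point extends to a `V`-point.
  obtain ⟨l, rfl⟩ : ∃ l : Spec (CommRingCat.of V) ⟶ X.left,
      Spec.map (CommRingCat.ofHom (algebraMap V E)) ≫ l = x := by
    obtain ⟨⟨l, hl, -⟩⟩ := (hexist ⟨V, E, x, Spec.map (CommRingCat.ofHom ρ), hsq⟩).exists_lift
    exact ⟨l, hl⟩
  obtain ⟨j, i', hj⟩ := hs (l (IsLocalRing.closedPoint V))
  have hi' : ⊤ ≤ l ⁻¹ᵁ L.U i' := top_le_preimage (X.left.basicOpen_le _ hj)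
  have hi'E : ⊤ ≤ (Spec.map (CommRingCat.ofHom (algebraMap V E)) ≫ l) ⁻¹ᵁ L.U i' :=
    le_top.trans (Scheme.Hom.preimage_mono _ hi')
  have hunit : IsUnit (ev l hi' ((s j).s i')) := (isUnit_ev_iff l hi' _).mpr hj
  refine ⟨j, fun h => ?_⟩
  -- In a trivialisation around the image of the closed point, the transition factor cancels and `u
  -- j` times the value of `t` in `V` is a unit of `V`. Hence `u j`, if it lies in `V`, is a unit.
  have e := hu j
  rw [t.ev_eq _ hi hi'E, (s j).ev_eq _ hi hi'E, mul_left_comm] at e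
  replace e := mul_left_cancel₀ (ev_unit_ne_zero _ _ _) e
  rw [ev_SpecMap l _ hi', ev_SpecMap l _ hi'] at e
  have e' : (⟨u j, h⟩ : V) * ev l hi' (t.s i') = ev l hi' ((s j).s i') := Subtype.ext e
  rw [IsLocalRing.notMem_maximalIdeal]
  exact isUnit_of_mul_isUnit_left (e' ▸ hunit)

/-- Integrality of `t` over the generating sections `s j`, on an affine open set. -/
theorem exists_aeval_eq_zero_of_isAffineOpen [IsProper X.hom] {n : ℕ}
    {s : Fin (n + 1) → L.GlobalSection}
    (hs : ∀ p : X.left, ∃ j i, p ∈ X.left.basicOpen ((s j).s i)) (t : L.GlobalSection)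
    {W : X.left.Opens} (hW : IsAffineOpen W) {i : L.ι} (hWi : W ≤ L.U i) :
    ∃ P : MvPolynomial (Fin (n + 1)) K, P.constantCoeff = 1 ∧
      ∀ (E : Type u) [Field E] [Algebra K E] (x : Spec (CommRingCat.of E) ⟶ X.left)
        (_ : x ≫ X.hom = Spec.map (CommRingCat.ofHom (algebraMap K E))) (_ : ⊤ ≤ x ⁻¹ᵁ W)
        (hi : ⊤ ≤ x ⁻¹ᵁ L.U i), ev x hi (t.s i) ≠ 0 →
        MvPolynomial.aeval (fun j => ev x hi ((s j).s i) / ev x hi (t.s i)) P = 0 := by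
  set t' : Γ(X.left, W) := rest hWi (t.s i)
  let s' : Fin (n + 1) → Γ(X.left, W) := fun j => rest hWi ((s j).s i)
  -- `R` is the ring of functions on the part of `W` where `t` does not vanish; there `u j` is the
  -- quotient `s j / t`.
  let R := Localization.Away t'
  let _ : Algebra K R := ((algebraMap Γ(X.left, W) R).comp (scalars W)).toAlgebra
  let u : Fin (n + 1) → R := fun j =>
    algebraMap Γ(X.left, W) R (s' j) * IsLocalization.Away.invSelf t'
  have hu : ∀ j, u j * algebraMap Γ(X.left, W) R t' = algebraMap Γ(X.left, W) R (s' j) := fun j => by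
    rw [mul_assoc, mul_comm (IsLocalization.Away.invSelf t'),
      IsLocalization.Away.mul_invSelf, mul_one]
  obtain ⟨P, hP1, hP⟩ := MvPolynomial.exists_aeval_eq_zero_of_valuationSubring (K := K) u
    fun E _ φ V hV => by
      let φ' : Γ(X.left, W) →+* E := φ.comp (algebraMap Γ(X.left, W) R)
      let ρ : K →+* V := (φ.comp (algebraMap K R)).codRestrict V.toSubring hV
      have hx : (Spec.map (CommRingCat.ofHom φ') ≫ hW.fromSpec) ≫ X.hom =
          Spec.map (CommRingCat.ofHom ((algebraMap V E).comp ρ)) := by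
        rw [Category.assoc, fromSpec_comp_hom, ← Spec.map_comp]
        rfl
      have hxW : ⊤ ≤ (Spec.map (CommRingCat.ofHom φ') ≫ hW.fromSpec) ⁻¹ᵁ W :=
        le_top.trans (Scheme.Hom.preimage_mono _ hW.fromSpec_preimage_self.ge)
      refine exists_notMem_maximalIdeal hs t V _ ρ hx
        (hxW.trans (Scheme.Hom.preimage_mono _ hWi)) (fun j => φ (u j)) fun j => ?_
      have e1 := (ev_rest _ hWi hxW (t.s i)).symm.trans (ev_fromSpec hW φ' hxW t')
      have e2 := (ev_rest _ hWi hxW ((s j).s i)).symm.trans (ev_fromSpec hW φ' hxW (s' j))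
      rw [e1, e2]
      exact (map_mul φ _ _).symm.trans (congrArg φ (hu j))
  refine ⟨P, hP1, fun E _ _ x hx hxW hi ht => ?_⟩
  have et : ev x hxW t' = ev x hi (t.s i) := ev_rest _ _ _ _
  have es : ∀ j, ev x hxW (s' j) = ev x hi ((s j).s i) := fun j => ev_rest _ _ _ _
  have htu : IsUnit (ev x hxW t') := by rw [et]; exact ht.isUnit
  let φ : R →+* E := IsLocalization.Away.lift t' htu
  have hφ : ∀ a, φ (algebraMap Γ(X.left, W) R a) = ev x hxW a :=
    IsLocalization.Away.lift_eq t' htu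
  let ψ : R →ₐ[K] E := { φ with commutes' := fun a => (hφ _).trans (ev_scalars x _ hx hxW a) }
  have hψ : (fun j => ev x hi ((s j).s i) / ev x hi (t.s i)) = fun j => ψ (u j) := funext fun j => by
    rw [div_eq_iff ht]
    have := congrArg φ (hu j)
    rw [map_mul, hφ, hφ, et, es] at this
    exact this.symm
  rw [hψ]
  exact (DFunLike.congr_fun (MvPolynomial.comp_aeval u ψ) P).symm.trans
    ((congrArg ψ hP).trans (map_zero ψ))

/-- Integrality of a section `t` over generating sections `s j` on a proper scheme. -/
theorem exists_aeval_eq_zero [IsProper X.hom] {n : ℕ}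
    {s : Fin (n + 1) → L.GlobalSection}
    (hs : ∀ p : X.left, ∃ j i, p ∈ X.left.basicOpen ((s j).s i)) (t : L.GlobalSection) :
    ∃ P : MvPolynomial (Fin (n + 1)) K, P.constantCoeff = 1 ∧
      ∀ (E : Type u) [Field E] [Algebra K E] (x : Spec (CommRingCat.of E) ⟶ X.left)
        (_ : x ≫ X.hom = Spec.map (CommRingCat.ofHom (algebraMap K E)))
        (i : L.ι) (hi : ⊤ ≤ x ⁻¹ᵁ L.U i), ev x hi (t.s i) ≠ 0 →
        MvPolynomial.aeval (fun j => ev x hi ((s j).s i) / ev x hi (t.s i)) P = 0 := by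
  have : CompactSpace X.left := QuasiCompact.compactSpace_of_compactSpace X.hom
  choose i hi using L.cover
  choose W hW hpW hWi using fun p => exists_isAffineOpen_mem_and_subset (hi p)
  obtain ⟨T, -, hT⟩ := isCompact_univ.elim_nhds_subcover (fun p => (W p : Set X.left))
    fun p _ => (W p).isOpen.mem_nhds (hpW p)
  choose P hP1 hP using fun p => exists_aeval_eq_zero_of_isAffineOpen (K := K) hs t (hW p) (hWi p)
  -- The product of the equations over a finite affine cover has constant coefficient `1` and
  -- vanishes wherever one factor does.
  refine ⟨∏ p ∈ T, P p, ?_, fun E _ _ x hx i' hi' ht => ?_⟩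
  · rw [map_prod]
    exact Finset.prod_eq_one fun p _ => hP1 p
  obtain ⟨p, hpT, hp⟩ := Set.mem_iUnion₂.mp (hT (Set.mem_univ (x (IsLocalRing.closedPoint E))))
  have hxW : ⊤ ≤ x ⁻¹ᵁ W p := top_le_preimage hp
  have hxi : ⊤ ≤ x ⁻¹ᵁ L.U (i p) := hxW.trans (x.preimage_mono (hWi p))
  rw [map_prod]
  refine Finset.prod_eq_zero hpT ?_
  have e0 := t.ev_eq x hi' hxi
  have hg := ev_unit_ne_zero x (top_le_preimage_inf hi' hxi) (L.g i' (i p))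
  have ht' : ev x hxi (t.s (i p)) ≠ 0 := fun h0 => ht (by rw [e0, h0, mul_zero])
  have := hP p E x hx hxW hxi ht'
  convert this using 3
  funext j
  rw [e0, (s j).ev_eq x hi' hxi, mul_div_mul_left _ _ hg]

end Integrality

/-! ### Heights for isomorphic line bundles -/

section Comparison

variable {K : Type u} [Field K] [NumberField K] {X : Over (Spec (CommRingCat.of K))}

theorem exists_height_le_of_same_bundle [IsProper X.hom] {L : LineBundle X.left} {n m : ℕ}
    (s : Fin (n + 1) → L.GlobalSection) (t : Fin (m + 1) → L.GlobalSection)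
    (hs : ∀ p : X.left, ∃ j i, p ∈ X.left.basicOpen ((s j).s i))
    (ht : ∀ p : X.left, ∃ j i, p ∈ X.left.basicOpen ((t j).s i)) :
    ∃ C : ℝ, ∀ x : GeomPoint X, (⟨L, m, t, ht⟩ : GeneratedBundle X.left).height x ≤
      (⟨L, n, s, hs⟩ : GeneratedBundle X.left).height x + C := by
  choose P hP1 hP using fun j => exists_aeval_eq_zero (K := K) hs (t j)
  obtain ⟨C, hC⟩ := exists_naiveHeight_le P hP1
  refine ⟨C, fun x => ?_⟩
  obtain ⟨i, hi⟩ := GeneratedBundle.exists_trivialisation ⟨L, n, s, hs⟩ x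
  rw [GeneratedBundle.height_eq ⟨L, n, s, hs⟩ x hi, GeneratedBundle.height_eq ⟨L, m, t, ht⟩ x hi]
  exact hC _ _ (GeneratedBundle.exists_ev_ne_zero ⟨L, n, s, hs⟩ x.pt hi)
    (GeneratedBundle.exists_ev_ne_zero ⟨L, m, t, ht⟩ x.pt hi)
    fun j hj => hP j (AlgebraicClosure K) x.pt (Over.w x) i hi hj

/-- The heights attached to generated bundles with isomorphic line bundles differ by a bounded
function. -/
theorem GeneratedBundle.exists_abs_height_sub_le [IsProper X.hom] (G H : GeneratedBundle X.left)
    (h : G.L ≈ H.L) : ∃ C : ℝ, ∀ x : GeomPoint X, |G.height x - H.height x| ≤ C := by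
  obtain ⟨G', H', hG, hH, L, n, m, s, t, hs, ht, rfl, rfl⟩ := exists_common_bundle G H h
  obtain ⟨C, hC⟩ := exists_height_le_of_same_bundle s t hs ht
  obtain ⟨D, hD⟩ := exists_height_le_of_same_bundle t s ht hs
  refine ⟨max C D, fun x => ?_⟩
  rw [← hG, ← hH, abs_sub_le_iff]
  exact ⟨(sub_le_iff_le_add'.mpr (hD x)).trans (le_max_right _ _),
    (sub_le_iff_le_add'.mpr (hC x)).trans (le_max_left _ _)⟩

end Comparison

/-! ### Fractions of equal degree on `Proj` -/

section ProjFractions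

variable {A σ : Type u} [CommRing A] [SetLike σ A] [AddSubgroupClass σ A] (𝒜 : ℕ → σ)
  [GradedRing 𝒜]

/-- The function `G / F` on the open subset of `Proj 𝒜` where `F` does not vanish. -/
def projFrac {m : ℕ} (F G : 𝒜 m) : Γ(Proj 𝒜, Proj.basicOpen 𝒜 (F : A)) :=
  (⟨fun p => .mk ⟨m, G, F, p.2⟩, fun p => ⟨_, p.2, 𝟙 _, m, G, F, fun x => x.2, fun _ => rfl⟩⟩ :
    (ProjectiveSpectrum.Proj.structureSheaf 𝒜).1.obj (op (ProjectiveSpectrum.basicOpen 𝒜 (F : A))))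

theorem projFrac_self {m : ℕ} (F : 𝒜 m) : projFrac 𝒜 F F = 1 := by
  refine Subtype.ext (funext fun p => HomogeneousLocalization.val_injective _ ?_)
  have := p.1.isPrime
  have h1 : ((1 : Γ(Proj 𝒜, Proj.basicOpen 𝒜 (F : A))) : (ProjectiveSpectrum.Proj.structureSheaf 𝒜).1.obj
    (op (ProjectiveSpectrum.basicOpen 𝒜 (F : A)))).1 p = 1 := rfl
  exact (Localization.mk_self (⟨(F : A), p.2⟩ : p.1.asHomogeneousIdeal.toIdeal.primeCompl)).trans
    ((HomogeneousLocalization.val_one (x := p.1.asHomogeneousIdeal.toIdeal.primeCompl)).symm.trans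
      (congrArg HomogeneousLocalization.val h1.symm))

theorem projFrac_mul {m : ℕ} (F G H : 𝒜 m) :
    rest (inf_le_left : Proj.basicOpen 𝒜 (F : A) ⊓ Proj.basicOpen 𝒜 (G : A) ≤ _)
      (projFrac 𝒜 F H) = rest inf_le_left (projFrac 𝒜 F G) * rest inf_le_right (projFrac 𝒜 G H) := by
  refine Subtype.ext (funext fun p => HomogeneousLocalization.val_injective _ ?_)
  have : p.1.asHomogeneousIdeal.toIdeal.IsPrime := p.1.isPrime
  have hF : (F : A) ∈ p.1.asHomogeneousIdeal.toIdeal.primeCompl := p.2.1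
  have hG : (G : A) ∈ p.1.asHomogeneousIdeal.toIdeal.primeCompl := p.2.2
  have : Localization.mk (H : A) ⟨(F : A), hF⟩ =
      Localization.mk (G : A) ⟨(F : A), hF⟩ * Localization.mk (H : A) ⟨(G : A), hG⟩ := by
    rw [Localization.mk_mul, Localization.mk_eq_mk_iff, Localization.r_iff_exists]
    exact ⟨1, by simp; ring⟩
  let S : Submonoid A := p.1.asHomogeneousIdeal.toIdeal.primeCompl
  let y : HomogeneousLocalization 𝒜 S := .mk ⟨m, G, F, hF⟩
  let z : HomogeneousLocalization 𝒜 S := .mk ⟨m, H, G, hG⟩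
  have e : (rest (inf_le_left : Proj.basicOpen 𝒜 (F : A) ⊓ Proj.basicOpen 𝒜 (G : A) ≤ _)
      (projFrac 𝒜 F G) * rest inf_le_right (projFrac 𝒜 G H) :
      (ProjectiveSpectrum.Proj.structureSheaf 𝒜).1.obj (op (ProjectiveSpectrum.basicOpen 𝒜 (F : A) ⊓
        ProjectiveSpectrum.basicOpen 𝒜 (G : A)))).1 p = y * z := rfl
  exact this.trans ((HomogeneousLocalization.val_mul y z).symm.trans
    (congrArg HomogeneousLocalization.val e.symm))

/-- A fraction which is a unit at `p` has its numerator outside the prime `p`; conversely `F / G`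
inverts `G / F` where neither vanishes. -/
theorem basicOpen_projFrac {m : ℕ} (F G : 𝒜 m) : (Proj 𝒜).basicOpen (projFrac 𝒜 F G) =
    Proj.basicOpen 𝒜 (F : A) ⊓ Proj.basicOpen 𝒜 (G : A) := by
  apply le_antisymm
  · intro p hp
    have hpF : p ∈ Proj.basicOpen 𝒜 (F : A) := (Proj 𝒜).basicOpen_le _ hp
    refine ⟨hpF, ?_⟩
    have : p.asHomogeneousIdeal.toIdeal.IsPrime := p.isPrime
    have hu := ((Proj 𝒜).mem_basicOpen _ p hpF).mp hp
    let S : Submonoid A := p.asHomogeneousIdeal.toIdeal.primeCompl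
    let φ : (Proj 𝒜).presheaf.stalk p →+* HomogeneousLocalization 𝒜 S :=
      (stalkToFiberRingHom 𝒜 p).hom
    have e : φ ((Proj 𝒜).presheaf.germ _ p hpF (projFrac 𝒜 F G)) =
        HomogeneousLocalization.mk ⟨m, G, F, hpF⟩ := stalkToFiberRingHom_germ 𝒜 _ p hpF _
    have hu2 : IsUnit (HomogeneousLocalization.mk
        (⟨m, G, F, hpF⟩ : HomogeneousLocalization.NumDenSameDeg 𝒜 S)) := e ▸ hu.map φ
    have hu3 := hu2.map (algebraMap (HomogeneousLocalization 𝒜 S) (Localization S))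
    have hu4 : IsUnit (IsLocalization.mk' (Localization p.asHomogeneousIdeal.toIdeal.primeCompl)
        (G : A) (⟨(F : A), hpF⟩ : p.asHomogeneousIdeal.toIdeal.primeCompl)) := by
      rw [← Localization.mk_eq_mk']; exact hu3
    exact (IsLocalization.AtPrime.isUnit_mk'_iff _ p.asHomogeneousIdeal.toIdeal _ _).mp hu4
  · have h := projFrac_mul 𝒜 F G F
    rw [projFrac_self, map_one] at h
    have hu : IsUnit (rest (inf_le_left :
        Proj.basicOpen 𝒜 (F : A) ⊓ Proj.basicOpen 𝒜 (G : A) ≤ _) (projFrac 𝒜 F G)) :=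
      IsUnit.of_mul_eq_one _ h.symm
    have h2 := basicOpen_rest (inf_le_left :
        Proj.basicOpen 𝒜 (F : A) ⊓ Proj.basicOpen 𝒜 (G : A) ≤ _) (projFrac 𝒜 F G)
    rw [Scheme.basicOpen_of_isUnit _ hu] at h2
    exact h2.le.trans inf_le_right

end ProjFractions

/-! ### Extension of sections and ample covers -/

section AffineLocalization

variable {X : Scheme.{u}} {U V : X.Opens}

/-- This is surjectivity in `Γ(X, D(f)) = Γ(X, U)_f`. The open set `V` is kept separate from
`X.basicOpen f` so that intersections of members of a cover can be inserted directly. -/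
theorem exists_rest_eq_pow_mul (hU : IsAffineOpen U) (f : Γ(X, U)) (h : V ≤ U)
    (e : V = X.basicOpen f) (c : Γ(X, V)) :
    ∃ (N : ℕ) (a : Γ(X, U)), rest h a = rest h f ^ N * c := by
  let _ := (X.presheaf.map (homOfLE h).op).hom.toAlgebra
  have := hU.isLocalization_of_eq_basicOpen f (homOfLE h) e
  obtain ⟨N, a, ha⟩ := IsLocalization.Away.surj f c
  exact ⟨N, a, ha.symm.trans (mul_comm _ _)⟩

theorem exists_pow_mul_eq_zero (hU : IsAffineOpen U) (f : Γ(X, U)) (h : V ≤ U)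
    (e : V = X.basicOpen f) (a : Γ(X, U)) (ha : rest h a = 0) : ∃ N : ℕ, f ^ N * a = 0 := by
  let _ := (X.presheaf.map (homOfLE h).op).hom.toAlgebra
  have := hU.isLocalization_of_eq_basicOpen f (homOfLE h) e
  obtain ⟨⟨_, N, rfl⟩, hN⟩ := (IsLocalization.map_eq_zero_iff (Submonoid.powers f) Γ(X, V) a).mp ha
  exact ⟨N, hN⟩

end AffineLocalization

/-- A finite cover of `X` by affine open sets, each being the non-vanishing locus of a section of
one line bundle; `f r s` is the quotient of the `s`-th section by the `r`-th one. -/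
structure AmpleCover (X : Scheme.{u}) where
  /-- the index set -/
  ι : Type u
  /-- the number of members, minus one -/
  n : ℕ
  /-- an enumeration of the index set -/
  e : Fin (n + 1) ≃ ι
  /-- the members of the cover -/
  V : ι → X.Opens
  cover : ∀ p : X, ∃ r, p ∈ V r
  affine : ∀ r, IsAffineOpen (V r)
  /-- the quotients of the sections -/
  f : ∀ r, ι → Γ(X, V r)
  basicOpen_f : ∀ r s, X.basicOpen (f r s) = V r ⊓ V s
  f_self : ∀ r, f r r = 1
  f_mul : ∀ r s u, rest (inf_le_left : V r ⊓ V s ≤ V r) (f r u) =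
    rest inf_le_left (f r s) * rest inf_le_right (f s u)

namespace AmpleCover

variable {X : Scheme.{u}} (P : AmpleCover X)

theorem rest_f_mul {W : X.Opens} {r s : P.ι} (hr : W ≤ P.V r) (hs : W ≤ P.V s) (u : P.ι) :
    rest hr (P.f r u) = rest hr (P.f r s) * rest hs (P.f s u) := by
  have := congrArg (rest (le_inf hr hs)) (P.f_mul r s u)
  rwa [map_mul, rest_rest, rest_rest, rest_rest] at this

/-- The transition functions `f r s`. -/
def unit (r s : P.ι) : Γ(X, P.V r ⊓ P.V s)ˣ where
  val := rest inf_le_left (P.f r s)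
  inv := rest inf_le_right (P.f s r)
  val_inv := by rw [← P.f_mul, P.f_self, map_one]
  inv_val := by rw [mul_comm, ← P.f_mul, P.f_self, map_one]

theorem res_unit {W : X.Opens} {r s : P.ι} (h : W ≤ P.V r ⊓ P.V s) :
    (res h (P.unit r s) : Γ(X, W)) = rest (h.trans inf_le_left) (P.f r s) :=
  rest_rest _ _ _

theorem res_unit_mul {W : X.Opens} {r s u : P.ι} (h₁ : W ≤ P.V r ⊓ P.V s)
    (h₂ : W ≤ P.V s ⊓ P.V u) (h₃ : W ≤ P.V r ⊓ P.V u) :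
    res h₁ (P.unit r s) * res h₂ (P.unit s u) = res h₃ (P.unit r u) := by
  ext
  rw [Units.val_mul, res_unit, res_unit, res_unit]
  exact (P.rest_f_mul _ _ _).symm

/-- The `N`-th power of the line bundle of the cover. -/
def line (N : ℕ) : LineBundle X where
  ι := P.ι
  U := P.V
  cover := P.cover
  g r s := P.unit r s ^ N
  cocycle r s u := by
    rw [map_pow, map_pow, map_pow, ← mul_pow, res_unit_mul]

/-- The `N`-th power of the line bundle of the cover, with the `N`-th powers of the sections. -/
def bundle (N : ℕ) : GeneratedBundle X where
  L := P.line N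
  n := P.n
  s j :=
    { s := fun r => P.f r (P.e j) ^ N
      compat := fun r s => by
        have := congrArg (· ^ N) (P.f_mul r s (P.e j))
        simp only [mul_pow] at this
        refine (map_pow (rest inf_le_left) _ _).trans (this.trans ?_)
        exact congrArg (_ * ·) (map_pow (rest inf_le_right) _ _).symm }
  generate p := by
    obtain ⟨r, hr⟩ := P.cover p
    refine ⟨P.e.symm r, r, ?_⟩
    have : P.f r (P.e (P.e.symm r)) ^ N = 1 := by rw [Equiv.apply_symm_apply, P.f_self, one_pow]
    exact (congrArg (p ∈ X.basicOpen ·) this).mpr (by rw [X.basicOpen_of_isUnit isUnit_one]; exact hr)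

variable {L : LineBundle X}

/-- The transition functions of `L` on a cover which refines the trivialising one. -/
def trans (α : P.ι → L.ι) (hα : ∀ r, P.V r ≤ L.U (α r))
    (r s : P.ι) : Γ(X, P.V r ⊓ P.V s)ˣ :=
  res (inf_le_inf (hα r) (hα s)) (L.g (α r) (α s))

theorem res_trans_mul (α : P.ι → L.ι) (hα : ∀ r, P.V r ≤ L.U (α r))
    {W : X.Opens} {r s u : P.ι} (h₁ : W ≤ P.V r ⊓ P.V s)
    (h₂ : W ≤ P.V s ⊓ P.V u) (h₃ : W ≤ P.V r ⊓ P.V u) :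
    res h₁ (P.trans α hα r s) * res h₂ (P.trans α hα s u) = res h₃ (P.trans α hα r u) := by
  simp only [trans, res_res]
  exact L.cocycle_res _ _ _

/-- The frame of `L` on `V u`, times the `N`-th power of the `u`-th section, has the right-hand side
as its coordinate in the `r`-th trivialisation. A high power of `f r u` removes its poles along the
complement of `V u` in `V r`. -/
theorem exists_local_sections (α : P.ι → L.ι) (hα : ∀ r, P.V r ≤ L.U (α r)) :
    ∃ (N : ℕ) (a : ∀ r, P.ι → Γ(X, P.V r)), ∀ r u,
    rest (inf_le_left : P.V r ⊓ P.V u ≤ P.V r) (a r u) =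
      rest inf_le_left (P.f r u) ^ N * (P.trans α hα r u).val := by
  have hfin : Finite P.ι := Finite.of_equiv _ P.e
  have key : ∀ᶠ N : ℕ in atTop, ∀ p : P.ι × P.ι, ∃ a : Γ(X, P.V p.1),
      rest (inf_le_left : P.V p.1 ⊓ P.V p.2 ≤ P.V p.1) a =
        rest inf_le_left (P.f p.1 p.2) ^ N * (P.trans α hα p.1 p.2).val := by
    rw [eventually_all]
    rintro ⟨r, u⟩
    obtain ⟨N, a, ha⟩ := exists_rest_eq_pow_mul (P.affine r) (P.f r u) inf_le_left
      (P.basicOpen_f r u).symm (P.trans α hα r u : Γ(X, P.V r ⊓ P.V u))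
    filter_upwards [eventually_ge_atTop N] with M hM
    refine ⟨P.f r u ^ (M - N) * a, ?_⟩
    rw [map_mul, map_pow, ha, ← mul_assoc, ← pow_add, Nat.sub_add_cancel hM]
  obtain ⟨N, hN⟩ := key.exists
  choose a ha using hN
  exact ⟨N, fun r u => a (r, u), fun r u => ha (r, u)⟩

/-- The extensions over `V r` and `V s` match on the triple intersection with `V u`, which is where
`f r u` is invertible in the affine set `V r ⊓ V s`. A further power of `f r u` therefore kills the
discrepancy, and finiteness of the cover allows one exponent for all triples. -/
theorem exists_compatible_sections (α : P.ι → L.ι) (hα : ∀ r, P.V r ≤ L.U (α r)) :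
    ∃ (N : ℕ) (b : ∀ r, P.ι → Γ(X, P.V r)),
    (∀ r s u, rest (inf_le_left : P.V r ⊓ P.V s ≤ P.V r) (b r u) =
      (P.trans α hα r s * P.unit r s ^ N).val * rest inf_le_right (b s u)) ∧
    ∀ r, X.basicOpen (b r r) = P.V r := by
  have hfin : Finite P.ι := Finite.of_equiv _ P.e
  obtain ⟨N, a, ha⟩ := P.exists_local_sections α hα
  have key : ∀ᶠ M : ℕ in atTop, ∀ p : P.ι × P.ι × P.ι,
      rest (inf_le_left : P.V p.1 ⊓ P.V p.2.1 ≤ P.V p.1) (P.f p.1 p.2.2) ^ M *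
        (rest (inf_le_left : P.V p.1 ⊓ P.V p.2.1 ≤ P.V p.1) (a p.1 p.2.2) -
        (P.trans α hα p.1 p.2.1 * P.unit p.1 p.2.1 ^ N).val *
          rest inf_le_right (a p.2.1 p.2.2)) = 0 := by
    rw [eventually_all]
    rintro ⟨r, s, u⟩
    have haff : IsAffineOpen (P.V r ⊓ P.V s) := by
      rw [← P.basicOpen_f]; exact (P.affine r).basicOpen _
    have hW : P.V r ⊓ P.V s ⊓ P.V u = X.basicOpen
        (rest (inf_le_left : P.V r ⊓ P.V s ≤ P.V r) (P.f r u)) := by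
      rw [basicOpen_rest, P.basicOpen_f, ← inf_inf_distrib_left, inf_assoc]
    have h₁ : P.V r ⊓ P.V s ⊓ P.V u ≤ P.V r ⊓ P.V s := inf_le_left
    have h₂ : P.V r ⊓ P.V s ⊓ P.V u ≤ P.V s ⊓ P.V u := inf_le_inf inf_le_right le_rfl
    have h₃ : P.V r ⊓ P.V s ⊓ P.V u ≤ P.V r ⊓ P.V u := inf_le_inf inf_le_left le_rfl
    have e1 := congrArg (rest h₃) (ha r u)
    have e2 := congrArg (rest h₂) (ha s u)
    have e3 := congrArg Units.val (P.res_trans_mul α hα h₁ h₂ h₃)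
    have e4 := P.rest_f_mul (h₁.trans inf_le_left) (h₂.trans inf_le_left) u
    rw [map_mul, map_pow, rest_rest, rest_rest] at e1 e2
    obtain ⟨M, hM⟩ := exists_pow_mul_eq_zero haff _ inf_le_left hW
      (rest (inf_le_left : P.V r ⊓ P.V s ≤ P.V r) (a r u) -
        (P.trans α hα r s * P.unit r s ^ N).val * rest inf_le_right (a s u)) (by
      rw [map_sub, map_mul, rest_rest, rest_rest, e1, e2, Units.val_mul, Units.val_pow_eq_pow_val,
        map_mul, map_pow, sub_eq_zero]
      refine (congrArg₂ (· * ·) (congrArg (· ^ N) e4) e3.symm).trans ?_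
      rw [Units.val_mul, ← coe_res, ← coe_res, ← coe_res, res_unit]
      ring)
    filter_upwards [eventually_ge_atTop M] with M' hM'
    rw [← Nat.sub_add_cancel hM', pow_add, mul_assoc, hM, mul_zero]
  obtain ⟨M, hM⟩ := key.exists
  -- Multiplying by the `M`-th power of the `u`-th section twists the bundle `M` more times, whence
  -- the exponent `N + M`.
  refine ⟨N + M, fun r u => P.f r u ^ M * a r u, fun r s u => ?_, fun r => ?_⟩
  · have e := hM (r, s, u)
    rw [mul_sub, sub_eq_zero] at e
    rw [map_mul, map_pow, e, map_mul, map_pow, P.f_mul r s u, pow_add]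
    simp only [Units.val_mul, Units.val_pow_eq_pow_val, unit]
    ring
  · refine le_antisymm (X.basicOpen_le _) ?_
    -- Since `f r r = 1`, the `r`-th section is a transition unit in its own trivialisation, so it
    -- vanishes nowhere on `V r`.
    have e := ha r r
    rw [P.f_self, map_one, one_pow, one_mul] at e
    have h := basicOpen_rest (inf_le_left : P.V r ⊓ P.V r ≤ P.V r) (a r r)
    rw [e, X.basicOpen_of_isUnit (P.trans α hα r r).isUnit] at h
    simp only [P.f_self, one_pow, one_mul]
    exact (le_inf le_rfl le_rfl).trans (h.le.trans inf_le_right)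

/-- If the cover trivialises `L`, then `L` is the difference of two line bundles which are
generated by finitely many global sections. -/
theorem exists_generatedBundle (α : P.ι → L.ι) (hα : ∀ r, P.V r ≤ L.U (α r)) :
    ∃ G H : GeneratedBundle X, G.L ≈ L.tensor H.L := by
  obtain ⟨N, b, hb, hb'⟩ := P.exists_compatible_sections α hα
  let B : LineBundle X :=
    { ι := P.ι
      U := P.V
      cover := P.cover
      g := fun r s => P.trans α hα r s * P.unit r s ^ N
      cocycle := fun r s u => by
        simp only [map_mul, map_pow]
        rw [mul_mul_mul_comm, res_trans_mul, ← mul_pow, res_unit_mul] }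
  refine ⟨⟨B, P.n, fun j => ⟨fun r => b r (P.e j), fun r s => hb r s (P.e j)⟩, fun p => ?_⟩,
    P.bundle N, LineBundle.iso_of_eq P.V P.cover id (fun r => (α r, r)) (fun _ => le_rfl)
      (fun r => le_inf (hα r) le_rfl) fun r s => ?_⟩
  · obtain ⟨r, hr⟩ := P.cover p
    refine ⟨P.e.symm r, r, ?_⟩
    have : X.basicOpen (b r (P.e (P.e.symm r))) = P.V r := by rw [Equiv.apply_symm_apply, hb']
    exact this.ge hr
  · refine (map_mul (res _) _ _).trans (Eq.trans ?_ (LineBundle.res_tensor_g L (P.line N)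
      (α r, r) (α s, s) _).symm)
    exact congrArg (· * _) (res_res _ _ _)

end AmpleCover

/-! ### Ample covers of closed subschemes of `Proj` -/

section ProjBasis

variable {A σ : Type u} [CommRing A] [SetLike σ A] [AddSubgroupClass σ A] (𝒜 : ℕ → σ)
  [GradedRing 𝒜]

/-- Positive degree is needed for the open set to be affine. As `p` does not contain the irrelevant
ideal, some homogeneous element of positive degree is nonzero at `p` and can be multiplied in. -/
theorem exists_homogeneous_mem_basicOpen {U : (Proj 𝒜).Opens} {p : Proj 𝒜} (hp : p ∈ U) :
    ∃ (d : ℕ) (F : 𝒜 d), 0 < d ∧ p ∈ Proj.basicOpen 𝒜 (F : A) ∧ Proj.basicOpen 𝒜 (F : A) ≤ U := by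
  obtain ⟨_, ⟨_, ⟨h, rfl⟩, rfl⟩, hph, hU⟩ := (Proj.isBasis_basicOpen 𝒜).exists_subset_of_mem_open hp U.2
  replace hph : p ∈ Proj.basicOpen 𝒜 h := hph
  rw [Proj.basicOpen_eq_iSup_proj] at hph
  obtain ⟨i, hi⟩ := Opens.mem_iSup.mp hph
  obtain ⟨g, hg, hgp⟩ := Set.not_subset.mp p.not_irrelevant_le
  have hpg : p ∈ Proj.basicOpen 𝒜 g := hgp
  rw [Proj.basicOpen_eq_iSup_proj] at hpg
  obtain ⟨k, hk⟩ := Opens.mem_iSup.mp hpg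
  have hk0 : 0 < k := by
    refine Nat.pos_of_ne_zero fun h0 => ?_
    subst h0
    rw [(HomogeneousIdeal.mem_irrelevant_iff 𝒜 g).mp hg, Proj.basicOpen_zero] at hk
    exact hk
  refine ⟨i + k, ⟨GradedRing.proj 𝒜 i h * GradedRing.proj 𝒜 k g,
    SetLike.mul_mem_graded (SetLike.coe_mem _) (SetLike.coe_mem _)⟩, by omega, ?_, ?_⟩
  · exact (SetLike.ext_iff.mp (Proj.basicOpen_mul 𝒜 _ _) p).mpr ⟨hi, hk⟩
  · refine le_trans ?_ hU
    rw [Proj.basicOpen_eq_iSup_proj 𝒜 h]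
    exact ((Proj.basicOpen_mul 𝒜 _ _).trans_le inf_le_left).trans
      (le_iSup (fun i => Proj.basicOpen 𝒜 (GradedRing.proj 𝒜 i h)) i)

variable {𝒜} {X : Scheme.{u}}

theorem exists_ampleCover [CompactSpace X] [Nonempty X] (j : X ⟶ Proj 𝒜) [IsClosedImmersion j]
    (L : LineBundle X) :
    ∃ (P : AmpleCover X) (α : P.ι → L.ι), ∀ r, P.V r ≤ L.U (α r) := by
  have h : ∀ p : X, ∃ (i : L.ι) (d : ℕ) (F : 𝒜 d), 0 < d ∧ p ∈ j ⁻¹ᵁ Proj.basicOpen 𝒜 (F : A) ∧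
      j ⁻¹ᵁ Proj.basicOpen 𝒜 (F : A) ≤ L.U i := fun p => by
    obtain ⟨i, hi⟩ := L.cover p
    obtain ⟨W, hW, e⟩ := j.isClosedEmbedding.isInducing.isOpen_iff.mp (L.U i).2
    have hpW : j p ∈ (⟨W, hW⟩ : (Proj 𝒜).Opens) := by
      have : p ∈ j ⁻¹' W := e ▸ hi
      exact this
    obtain ⟨d, F, hd, hF, hFW⟩ := exists_homogeneous_mem_basicOpen 𝒜 hpW
    exact ⟨i, d, F, hd, hF, (j.preimage_mono hFW).trans e.le⟩
  choose i d F hd hF hFi using h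
  obtain ⟨t, ht⟩ := CompactSpace.elim_nhds_subcover
    (fun p => ((j ⁻¹ᵁ Proj.basicOpen 𝒜 (F p : A) : X.Opens) : Set X))
    (fun p => (j ⁻¹ᵁ Proj.basicOpen 𝒜 (F p : A)).2.mem_nhds (hF p))
  have hcov : ∀ p : X, ∃ r : t, p ∈ j ⁻¹ᵁ Proj.basicOpen 𝒜 (F r : A) := fun p => by
    have : p ∈ (⊤ : Set X) := trivial
    rw [← ht] at this
    obtain ⟨r, hr, hp⟩ := Set.mem_iUnion₂.mp this
    exact ⟨⟨r, hr⟩, hp⟩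
  -- Powers bring all the `F p` to the common degree `m` without changing where they vanish, so that
  -- their quotients are functions.
  let m := ∏ p ∈ t, d p
  have hm : 0 < m := Finset.prod_pos fun p _ => hd p
  have hdm : ∀ r : t, m / d r * d r = m := fun r => Nat.div_mul_cancel (Finset.dvd_prod_of_mem d r.2)
  let F' : t → 𝒜 m := fun r => ⟨(F r : A) ^ (m / d r), by
    have := SetLike.pow_mem_graded (m / d r) (F r).2
    rwa [smul_eq_mul, hdm] at this⟩
  have hF' : ∀ r, Proj.basicOpen 𝒜 (F' r : A) = Proj.basicOpen 𝒜 (F r : A) := fun r =>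
    Proj.basicOpen_pow 𝒜 _ _ (Nat.pos_of_ne_zero fun h0 => by
      have := hdm r
      rw [h0, zero_mul] at this
      omega)
  obtain ⟨r₀, -⟩ := hcov (Classical.arbitrary X)
  have hcard : Fintype.card t - 1 + 1 = Fintype.card t :=
    Nat.sub_add_cancel (Fintype.card_pos_iff.mpr ⟨r₀⟩)
  refine ⟨{ ι := t
            n := Fintype.card t - 1
            e := (finCongr hcard).trans (Fintype.equivFin t).symm
            V := fun r => j ⁻¹ᵁ Proj.basicOpen 𝒜 (F' r : A)
            cover := fun p => by simpa only [hF'] using hcov p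
            affine := fun r => (Proj.isAffineOpen_basicOpen 𝒜 _ (F' r).2 hm).preimage j
            f := fun r s => j.app _ (projFrac 𝒜 (F' r) (F' s))
            basicOpen_f := fun r s => by
              rw [← Scheme.preimage_basicOpen, basicOpen_projFrac]
              rfl
            f_self := fun r => by rw [projFrac_self, map_one]
            f_mul := fun r s u => by
              have := congrArg (j.app _) (projFrac_mul 𝒜 (F' r) (F' s) (F' u))
              rw [map_mul, app_rest, app_rest, app_rest] at this
              exact this }, fun r => i r, fun r => ?_⟩
  change j ⁻¹ᵁ Proj.basicOpen 𝒜 (F' r : A) ≤ _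
  rw [hF']
  exact hFi r

end ProjBasis

/-- On the empty scheme, all line bundles are isomorphic. -/
theorem LineBundle.iso_of_isEmpty {X : Scheme.{u}} [IsEmpty X] (L M : LineBundle X) : L ≈ M :=
  LineBundle.iso_of_eq (κ := PEmpty) (fun a => a.elim) (fun p => isEmptyElim p) (fun a => a.elim)
    (fun a => a.elim) (fun a => a.elim) (fun a => a.elim) fun a => a.elim

attribute [local instance] MvPolynomial.gradedAlgebra in
/-- On a projective scheme every line bundle is the difference of two line bundles which are
generated by finitely many global sections. -/
theorem IsProjective.exists_generatedBundle {K : Type u} [Field K]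
    {X : Over (Spec (CommRingCat.of K))} (hX : IsProjective X) (L : LineBundle X.left) :
    ∃ G H : GeneratedBundle X.left, G.L ≈ L.tensor H.L := by
  have := hX.isProper
  have : CompactSpace X.left := QuasiCompact.compactSpace_of_compactSpace X.hom
  rcases isEmpty_or_nonempty X.left with h | h
  -- An `AmpleCover` has at least one member, so the empty scheme is treated separately.
  · let G : GeneratedBundle X.left :=
      ⟨LineBundle.trivial X.left, 0, fun _ => ⟨fun _ => 0, fun _ _ => by simp⟩,
        fun p => isEmptyElim p⟩
    exact ⟨G, G, LineBundle.iso_of_isEmpty _ _⟩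
  · obtain ⟨n, j, hj⟩ := hX
    have hj' : IsClosedImmersion (Y := Proj (MvPolynomial.homogeneousSubmodule (Fin (n + 1)) K))
      j.left := hj
    obtain ⟨P, α, hα⟩ := exists_ampleCover
      (𝒜 := MvPolynomial.homogeneousSubmodule (Fin (n + 1)) K) j.left L
    exact P.exists_generatedBundle α hα

/-! ### The height machine modulo bounded functions -/

/-- The space of bounded real functions on a set. -/
def boundedFunctions (S : Type*) : Submodule ℝ (S → ℝ) where
  carrier := {h | ∃ C : ℝ, ∀ x, |h x| ≤ C}
  zero_mem' := ⟨0, fun _ => by simp⟩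
  add_mem' := by
    rintro a b ⟨C, hC⟩ ⟨D, hD⟩
    exact ⟨C + D, fun x => (abs_add_le _ _).trans (add_le_add (hC x) (hD x))⟩
  smul_mem' := by
    rintro r a ⟨C, hC⟩
    refine ⟨|r| * C, fun x => ?_⟩
    rw [Pi.smul_apply, smul_eq_mul, abs_mul]
    exact mul_le_mul_of_nonneg_left (hC x) (abs_nonneg r)

theorem mem_boundedFunctions {S : Type*} {h : S → ℝ} :
    h ∈ boundedFunctions S ↔ ∃ C : ℝ, ∀ x, |h x| ≤ C := Iff.rfl

/-- Real functions on a set up to bounded functions. -/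
abbrev FunctionsModBounded (S : Type*) : Type _ := (S → ℝ) ⧸ boundedFunctions S

/-- The class of a function up to bounded functions. -/
abbrev modBounded {S : Type*} : (S → ℝ) →ₗ[ℝ] FunctionsModBounded S := (boundedFunctions S).mkQ

theorem modBounded_eq {S : Type*} {h h' : S → ℝ} :
    modBounded h = modBounded h' ↔ ∃ C : ℝ, ∀ x, |h x - h' x| ≤ C :=
  (Submodule.Quotient.eq (boundedFunctions S)).trans mem_boundedFunctions

theorem IsProjective.exists_pic_eq {K : Type u} [Field K] {X : Over (Spec (CommRingCat.of K))}
    (hX : IsProjective X) (c : Pic X.left) :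
    ∃ G H : GeneratedBundle X.left, Pic.mk G.L = c * Pic.mk H.L := by
  obtain ⟨L, rfl⟩ := Quotient.exists_rep c
  obtain ⟨G, H, h⟩ := hX.exists_generatedBundle L
  exact ⟨G, H, Quotient.sound h⟩

theorem IsProjective.span_eq_top {K : Type u} [Field K] {X : Over (Spec (CommRingCat.of K))}
    (hX : IsProjective X) :
    Submodule.span ℝ (Set.range fun G : GeneratedBundle X.left => RPic.of G.L) = ⊤ := by
  refine top_le_iff.mp fun L _ => ?_
  refine TensorProduct.induction_on L (zero_mem _) (fun r c => ?_) fun a b ha hb => add_mem ha hb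
  · obtain ⟨G, H, h⟩ := hX.exists_pic_eq c.toMul
    have hc : c = Additive.ofMul (Pic.mk G.L) - Additive.ofMul (Pic.mk H.L) := by
      rw [h, ofMul_mul, ofMul_toMul, add_sub_cancel_right]
    have : TensorProduct.tmul ℤ r c = r • (RPic.of G.L - RPic.of H.L) := by
      rw [RPic.of, RPic.of, ← TensorProduct.tmul_sub, ← hc, TensorProduct.smul_tmul', smul_eq_mul,
        mul_one]
    rw [this]
    exact Submodule.smul_mem _ _ (sub_mem (Submodule.subset_span ⟨G, rfl⟩)
      (Submodule.subset_span ⟨H, rfl⟩))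

section HeightMachine

variable {K : Type u} [Field K] [NumberField K] {X Y : Over (Spec (CommRingCat.of K))}

/-- Cross-multiplication turns an equality of differences into an isomorphism of generated bundles,
to which the comparison of heights applies. -/
theorem modBounded_height_sub (hX : IsProjective X) {G H G' H' : GeneratedBundle X.left}
    (h : Pic.mk G.L * Pic.mk H'.L = Pic.mk G'.L * Pic.mk H.L) :
    modBounded (G.height (X := X) - H.height) = modBounded (G'.height (X := X) - H'.height) := by
  have := hX.isProper
  obtain ⟨C, hC⟩ := GeneratedBundle.exists_abs_height_sub_le (X := X) (G.tensor H') (G'.tensor H)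
    (Quotient.exact h)
  refine modBounded_eq.mpr ⟨C, fun x => ?_⟩
  have := hC x
  rw [GeneratedBundle.height_tensor, GeneratedBundle.height_tensor] at this
  rw [Pi.sub_apply, Pi.sub_apply]
  convert this using 2
  ring

/-- The height of an isomorphism class of line bundles, up to bounded functions. -/
def picHeight (hX : IsProjective X) :
    Additive (Pic X.left) →+ FunctionsModBounded (GeomPoint X) :=
  AddMonoidHom.mk' (fun c => modBounded ((hX.exists_pic_eq c.toMul).choose.height (X := X) -
    (hX.exists_pic_eq c.toMul).choose_spec.choose.height)) fun a b => by
      have ha := (hX.exists_pic_eq a.toMul).choose_spec.choose_spec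
      have hb := (hX.exists_pic_eq b.toMul).choose_spec.choose_spec
      have hab := (hX.exists_pic_eq (a + b).toMul).choose_spec.choose_spec
      generalize (hX.exists_pic_eq a.toMul).choose_spec.choose = Ha at *
      generalize (hX.exists_pic_eq a.toMul).choose = Ga at *
      generalize (hX.exists_pic_eq b.toMul).choose_spec.choose = Hb at *
      generalize (hX.exists_pic_eq b.toMul).choose = Gb at *
      generalize (hX.exists_pic_eq (a + b).toMul).choose_spec.choose = H at *
      generalize (hX.exists_pic_eq (a + b).toMul).choose = G at *
      have e : Pic.mk G.L * Pic.mk (Ha.tensor Hb).L = Pic.mk (Ga.tensor Gb).L * Pic.mk H.L := by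
        change Pic.mk G.L * (Pic.mk Ha.L * Pic.mk Hb.L) = Pic.mk Ga.L * Pic.mk Gb.L * Pic.mk H.L
        rw [ha, hb, hab, toMul_add]
        simp only [mul_assoc, mul_left_comm, mul_comm]
      rw [modBounded_height_sub hX e, ← map_add]
      refine congrArg modBounded (funext fun x => ?_)
      simp only [Pi.sub_apply, Pi.add_apply, GeneratedBundle.height_tensor]
      ring

theorem picHeight_of (hX : IsProjective X) (G : GeneratedBundle X.left) :
    picHeight hX (Additive.ofMul (Pic.mk G.L)) = modBounded G.height := by
  have h := (hX.exists_pic_eq (Pic.mk G.L)).choose_spec.choose_spec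
  -- The class of `G` is the difference of those of `G ⊗ G` and `G`, whose heights differ by exactly
  -- the height of `G`.
  refine (modBounded_height_sub hX (G' := G.tensor G) (H' := G) ?_).trans
    (congrArg modBounded (funext fun x => ?_))
  · change _ = Pic.mk G.L * Pic.mk G.L * _
    rw [mul_assoc, ← h, mul_comm]
  · rw [Pi.sub_apply, GeneratedBundle.height_tensor, add_sub_cancel_right]

/-- The height of an `ℝ`-line bundle, up to bounded functions. -/
def heightClass (hX : IsProjective X) : RPic X.left →ₗ[ℝ] FunctionsModBounded (GeomPoint X) :=
  LinearMap.liftBaseChange ℝ (picHeight hX).toIntLinearMap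

theorem heightClass_of (hX : IsProjective X) (G : GeneratedBundle X.left) :
    heightClass hX (RPic.of G.L) = modBounded G.height := by
  refine (LinearMap.liftBaseChange_tmul _ _ _ _).trans ?_
  rw [one_smul]
  exact picHeight_of hX G

theorem IsProjective.exists_isWeilHeight (hX : IsProjective X) (L : RPic X.left) :
    ∃ h : GeomPoint X → ℝ, IsWeilHeight L h := by
  have hL : L ∈ Submodule.span ℝ (Set.range fun G : GeneratedBundle X.left => RPic.of G.L) := by
    rw [hX.span_eq_top]; trivial
  obtain ⟨m, r, g, hg⟩ := Submodule.mem_span_set'.mp hL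
  choose G hG using fun i => (g i).2
  refine ⟨fun x => ∑ i, r i * (G i).height x, m, r, G, ?_, 0, fun x => by simp⟩
  rw [← hg]
  exact Finset.sum_congr rfl fun i _ => congrArg (r i • ·) (hG i).symm

/-- Linearity of `heightClass` makes the class of a Weil height independent of the decomposition of
`L`; no relation in the tensor product has to be unravelled. -/
theorem IsWeilHeight.heightClass_eq (hX : IsProjective X) {L : RPic X.left}
    {h : GeomPoint X → ℝ} (hL : IsWeilHeight L h) : heightClass hX L = modBounded h := by
  obtain ⟨m, r, G, rfl, C, hC⟩ := hL
  rw [map_sum]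
  simp only [map_smul, heightClass_of]
  rw [eq_comm]
  simp only [← map_smul]
  rw [← map_sum]
  refine modBounded_eq.mpr ⟨C, fun x => ?_⟩
  simpa only [Finset.sum_apply, Pi.smul_apply, smul_eq_mul] using hC x

theorem IsWeilHeight.of_bounded {L : RPic X.left} {h h' : GeomPoint X → ℝ}
    (hL : IsWeilHeight L h) (hb : ∃ C : ℝ, ∀ x, |h' x - h x| ≤ C) : IsWeilHeight L h' := by
  obtain ⟨m, r, G, e, C, hC⟩ := hL
  obtain ⟨D, hD⟩ := hb
  exact ⟨m, r, G, e, D + C, fun x => (abs_sub_le _ (h x) _).trans (add_le_add (hD x) (hC x))⟩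

theorem IsWeilHeight.pullback {L : RPic Y.left} {h : GeomPoint Y → ℝ} (hL : IsWeilHeight L h)
    (f : X ⟶ Y) : IsWeilHeight (RPic.pullback f.left L) fun x : GeomPoint X => h (x ≫ f) := by
  obtain ⟨m, r, G, rfl, C, hC⟩ := hL
  refine ⟨m, r, fun i => (G i).pullback f.left, ?_, C, fun x => ?_⟩
  · rw [map_sum]
    exact Finset.sum_congr rfl fun i _ => map_smul _ _ _
  · simp only [GeneratedBundle.height_pullback]
    exact hC _

/-- If `∑ f_i^* L = d L`, then a Weil height for `L` satisfies the corresponding relation up to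
bounded functions. -/
theorem IsWeilHeight.exists_abs_sum_sub_le (hX : IsProjective X) {k : ℕ} {f : Fin k → (X ⟶ X)}
    {L : RPic X.left} {d : ℝ} (hf : ∑ i, RPic.pullback (f i).left L = d • L)
    {h : GeomPoint X → ℝ} (hL : IsWeilHeight L h) :
    ∃ C : ℝ, ∀ x, |∑ i, h (x ≫ f i) - d * h x| ≤ C := by
  have e := congrArg (heightClass hX) hf
  rw [map_sum, map_smul, hL.heightClass_eq hX,
    Finset.sum_congr rfl fun i _ => (hL.pullback (f i)).heightClass_eq hX, ← map_sum,
    ← map_smul] at e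
  obtain ⟨C, hC⟩ := modBounded_eq.mp e
  refine ⟨C, fun x => ?_⟩
  simpa only [Finset.sum_apply, Pi.smul_apply, smul_eq_mul] using hC x

end HeightMachine

/-! ### Tate's limiting argument -/

section TateLimit

variable {S : Type*} {k : ℕ} (φ : Fin k → S → S)

/-- The operator taking a function `h` to the sum of the functions `h ∘ φ i`. -/
def transfer (h : S → ℝ) (x : S) : ℝ := ∑ i, h (φ i x)

theorem transfer_sub (g h : S → ℝ) : transfer φ (g - h) = transfer φ g - transfer φ h :=
  funext fun _ => Finset.sum_sub_distrib _ _

theorem abs_transfer_le {g : S → ℝ} {C : ℝ} (hg : ∀ x, |g x| ≤ C) (x : S) :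
    |transfer φ g x| ≤ k * C := by
  refine (Finset.abs_sum_le_sum_abs _ _).trans ((Finset.sum_le_sum fun i _ => hg _).trans ?_)
  simp

variable {φ} {d : ℝ}

/-- The error at stage `l + 1` is the transfer of the error at stage `l`, and a sum of `k` terms
costs a factor `k`. -/
theorem abs_transfer_iterate_sub_le {h : S → ℝ} {C : ℝ}
    (hC : ∀ x, |transfer φ h x - d * h x| ≤ C) (l : ℕ) :
    ∀ x, |(transfer φ)^[l + 1] h x - d * (transfer φ)^[l] h x| ≤ k ^ l * C := by
  induction l with
  | zero => simpa using hC
  | succ l ih =>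
    intro x
    have := abs_transfer_le φ ih x
    rw [pow_succ', mul_assoc]
    refine le_of_eq_of_le (congrArg abs ?_) this
    rw [Function.iterate_succ_apply', Function.iterate_succ_apply' _ l, transfer, transfer, transfer,
      Finset.sum_sub_distrib, Finset.mul_sum]

theorem dist_transfer_iterate_div_le (hd : (k : ℝ) < d) {h : S → ℝ} {C : ℝ}
    (hC : ∀ x, |transfer φ h x - d * h x| ≤ C) (x : S) (l : ℕ) :
    dist ((transfer φ)^[l] h x / d ^ l) ((transfer φ)^[l + 1] h x / d ^ (l + 1)) ≤
      C / d * (k / d) ^ l := by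
  have hd0 : 0 < d := k.cast_nonneg.trans_lt hd
  have h1 : (transfer φ)^[l] h x / d ^ l - (transfer φ)^[l + 1] h x / d ^ (l + 1) =
      -((transfer φ)^[l + 1] h x - d * (transfer φ)^[l] h x) / d ^ (l + 1) := by
    field_simp
    ring
  rw [Real.dist_eq, h1, abs_div, abs_neg, abs_of_pos (pow_pos hd0 _), div_pow, div_mul_div_comm,
    ← pow_succ', mul_comm C]
  exact div_le_div_of_nonneg_right (abs_transfer_iterate_sub_le hC l x) (pow_pos hd0 _).le

/-- Tate's limiting argument. -/
theorem exists_transfer_eigenfunction (hd : (k : ℝ) < d) {h : S → ℝ}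
    (hb : ∃ C : ℝ, ∀ x, |transfer φ h x - d * h x| ≤ C) :
    ∃ hhat : S → ℝ, (∃ C : ℝ, ∀ x, |hhat x - h x| ≤ C) ∧
      (∀ x, transfer φ hhat x = d * hhat x) ∧
      ∀ x, Tendsto (fun l : ℕ => (transfer φ)^[l] h x / d ^ l) atTop (𝓝 (hhat x)) := by
  obtain ⟨C, hC⟩ := hb
  have hd0 : 0 < d := k.cast_nonneg.trans_lt hd
  have hr : (k : ℝ) / d < 1 := (div_lt_one hd0).mpr hd
  have hdist := fun x => dist_transfer_iterate_div_le hd hC x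
  choose hhat hlim using fun x => cauchySeq_tendsto_of_complete
    (cauchySeq_of_le_geometric _ _ hr (hdist x))
  refine ⟨hhat, ⟨C / d / (1 - k / d), fun x => ?_⟩, fun x => ?_, hlim⟩
  · have := dist_le_of_le_geometric_of_tendsto₀ _ _ hr (hdist x) (hlim x)
    rw [dist_comm, Real.dist_eq] at this
    simpa using this
  -- A finite sum commutes with the limit, and a transferred term is `d` times the next term of the
  -- sequence.
  · refine tendsto_nhds_unique (tendsto_finsetSum _ fun i _ => hlim (φ i x))
      (((tendsto_add_atTop_iff_nat 1).mpr (hlim x)).const_mul d |>.congr fun l => ?_)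
    rw [← Finset.sum_div, Function.iterate_succ_apply', transfer, pow_succ]
    field_simp

/-- The eigenvalue equation improves any bound on `g - h` by the factor `k / d < 1`, and this can be
repeated indefinitely. -/
theorem eq_of_transfer_eq (hd : (k : ℝ) < d) {g h : S → ℝ} (hg : ∀ x, transfer φ g x = d * g x)
    (hh : ∀ x, transfer φ h x = d * h x) (hb : ∃ C : ℝ, ∀ x, |g x - h x| ≤ C) : g = h := by
  obtain ⟨C, hC⟩ := hb
  have hd0 : 0 < d := k.cast_nonneg.trans_lt hd
  have key : ∀ l : ℕ, ∀ x, |(g - h) x| ≤ (k / d) ^ l * C := fun l => by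
    induction l with
    | zero => simpa using hC
    | succ l ih =>
      intro x
      have h1 := abs_transfer_le φ ih x
      rw [transfer_sub, Pi.sub_apply, hg, hh, ← mul_sub, abs_mul, abs_of_pos hd0] at h1
      rw [pow_succ', mul_assoc, div_mul_eq_mul_div, le_div_iff₀ hd0, mul_comm]
      exact h1
  refine funext fun x => ?_
  have h0 : Tendsto (fun l : ℕ => ((k : ℝ) / d) ^ l * C) atTop (𝓝 0) := by
    simpa using (tendsto_pow_atTop_nhds_zero_of_lt_one (by positivity)
      ((div_lt_one hd0).mpr hd)).mul_const C
  have := ge_of_tendsto' h0 fun l => key l x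
  exact sub_eq_zero.mp (abs_nonpos_iff.mp this)

end TateLimit

/-- The letter `w 0` is applied last to the point, so summing over it replaces `h` by its transfer;
this is why the induction varies `h`. -/
theorem sum_wordMap {C : Type*} [Category C] {T X : C} {k : ℕ} (f : Fin k → (X ⟶ X))
    (l : ℕ) (h : (T ⟶ X) → ℝ) (x : T ⟶ X) : ∑ w : Fin l → Fin k, h (x ≫ wordMap f l w) =
      (transfer fun i (y : T ⟶ X) => y ≫ f i)^[l] h x := by
  induction l generalizing h with
  | zero => simp [wordMap]
  | succ l ih =>
    rw [Function.iterate_succ_apply, ← ih,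
      ← (Fin.consEquiv fun _ => Fin k).sum_comp, Fintype.sum_prod_type_right]
    refine Finset.sum_congr rfl fun w _ => Finset.sum_congr rfl fun i _ => ?_
    simp [wordMap, Fin.consEquiv]

end CanonicalHeight

end

/-! ### The canonical height -/

theorem theorem1p2p1 {K : Type u} [Field K] [NumberField K]
    (X : Over (Spec (CommRingCat.of K))) (hX : CanonicalHeight.IsProjective X)
    (k : ℕ) (f : Fin k → (X ⟶ X)) (L : CanonicalHeight.RPic X.left)
    (d : ℝ) (hd : (k : ℝ) < d)
    (hL : ∑ i, CanonicalHeight.RPic.pullback (f i).left L = d • L) :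
    ∃ hhat : CanonicalHeight.GeomPoint X → ℝ,
      (CanonicalHeight.IsWeilHeight L hhat ∧
        ∀ x, ∑ i, hhat (x ≫ f i) = d * hhat x) ∧
      (∀ h' : CanonicalHeight.GeomPoint X → ℝ,
        CanonicalHeight.IsWeilHeight L h' → (∀ x, ∑ i, h' (x ≫ f i) = d * h' x) → h' = hhat) ∧
      (∀ h : CanonicalHeight.GeomPoint X → ℝ, CanonicalHeight.IsWeilHeight L h →
        (∃ C : ℝ, ∀ x, |hhat x - h x| ≤ C) ∧
        ∀ x, Tendsto (fun l : ℕ => (∑ w : Fin l → Fin k,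
          h (x ≫ CanonicalHeight.wordMap f l w)) / d ^ l) atTop (𝓝 (hhat x))) := by

  have key : ∀ h : CanonicalHeight.GeomPoint X → ℝ, CanonicalHeight.IsWeilHeight L h →
      ∃ hhat : CanonicalHeight.GeomPoint X → ℝ, (∃ C : ℝ, ∀ x, |hhat x - h x| ≤ C) ∧
        (∀ x, ∑ i, hhat (x ≫ f i) = d * hhat x) ∧
        ∀ x, Tendsto (fun l : ℕ => (∑ w : Fin l → Fin k,
          h (x ≫ CanonicalHeight.wordMap f l w)) / d ^ l) atTop (𝓝 (hhat x)) := fun h hh => by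
    simp only [CanonicalHeight.sum_wordMap]
    exact CanonicalHeight.exists_transfer_eigenfunction
      (φ := fun i (y : CanonicalHeight.GeomPoint X) => y ≫ f i) hd (hh.exists_abs_sum_sub_le hX hL)
  have uniq : ∀ g h : CanonicalHeight.GeomPoint X → ℝ, CanonicalHeight.IsWeilHeight L g →
      CanonicalHeight.IsWeilHeight L h → (∀ x, ∑ i, g (x ≫ f i) = d * g x) →
      (∀ x, ∑ i, h (x ≫ f i) = d * h x) → g = h := fun g h hg hh eg eh =>
    CanonicalHeight.eq_of_transfer_eq
      (φ := fun i (y : CanonicalHeight.GeomPoint X) => y ≫ f i) hd eg eh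
      (CanonicalHeight.modBounded_eq.mp
        ((hg.heightClass_eq hX).symm.trans (hh.heightClass_eq hX)))
  obtain ⟨h₀, hh₀⟩ := hX.exists_isWeilHeight L
  obtain ⟨hhat, hb, he, -⟩ := key h₀ hh₀
  have hw := hh₀.of_bounded hb
  refine ⟨hhat, ⟨hw, he⟩, fun h' hw' he' => uniq h' hhat hw' hw he' he, fun h hh => ?_⟩
  obtain ⟨hhat', hb', he', hlim⟩ := key h hh
  -- The limit built from `h` is again a Weil height and an eigenfunction, so uniqueness identifies
  -- it with the one built from `h₀`.
  obtain rfl := uniq hhat' hhat (hh.of_bounded hb') hw he' he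
  exact ⟨hb', hlim⟩
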